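/- **Setting.** Let $\mathcal C$ be a partition of $[n]$ into nonempty clusters and $0\le q<p\le 1$. In the planted partition model $\mathcal G(n,\mathcal C,p,q)$ a random graph $\hat G$ on $[n]$ has each pair $uv$, $u\ne v$, as an edge independently, with probability $p$ if $u,v$ lie in the same cluster and $q$ otherwise. Let $\varepsilon,c>0$. We say that $\mathcal C$ *forms superclusters with parameters $(\varepsilon,c)$* if $\mathcal C=\mathcal C_1\sqcup\dots\sqcup\mathcal C_K$ with nonempty $\mathcal C_i$ such that * $|C|\ge c\sqrt n$ for all $C\in\mathcal C$; * $\min_{C\in\mathcal C_i}|C|\ge \max_{C\in\mathcal C_{i+1}}|C|+c\sqrt n$ for $1\le i<K$; * $\max_{C\in\mathcal C_i}|C|\le(1+\varepsilon)\min_{C\in\mathcal C_i}|C|$ for $1\le i\le K$. Write $k_i=|\mathcal C_i|$. **Algorithm (nonuniform iterated projection).** The algorithm knows $p,q,\varepsilon$ and the supercluster sizes $k_1,\dots,k_K$, and receives a graph $\hat G=(\hat V,\hat E)$, initially with $\hat V=[n]$. While the list of supercluster sizes is nonempty: 1. Let $m=|\hat V|$, let $\hat A$ be the adjacency matrix of $\hat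 G$, and $\hat B=\hat A+pI_m-qJ_m$, where $J_m$ is the all-ones matrix. 2. Let $P=(\hat p_{uv})_{u,v\in\hat V}$ be the orthogonal projection onto the span of orthonormal eigenvectors of $\hat B$ for its $k_1$ largest eigenvalues. 3. Let $\hat s=(\lambda_1(\hat B)+7\sqrt m)/(p-q)$, where $\lambda_1$ is the largest eigenvalue. 4. For $v\in\hat V$ let $W_v=\{u\in\hat V:\hat p_{uv}\ge \frac1{2\hat s}\}$. 5. Let $v^*$ maximize $\|P\mathbf 1_{W_v}\|_2$ among all $v$ with $|W_v|\le(1+\varepsilon)\hat s$. If there is no such $v$, the algorithm fails. 6. Let $C$ be the set of vertices of $\hat G$ that have at least $(p-10\varepsilon)\hat s$ neighbours in $W_{v^*}$. Output $C$. 7. Replace $\hat G$ by $\hat G[\hat V\setminus C]$, and the list $k_1,k_2,\dots,k_K$ by $k_1-1,k_2,\dots,k_K$ if $k_1>1$, and by $k_2,\dots,k_K$ if $k_1=1$; renumber the list. We say that the algorithm recovers $\mathcal C$ from $\hat G$ if, however ties between eigenvalues in step 2 and between maximizers in step 5 are broken, it does not fail and the sets it outputs are exactly the clusters in $\mathcal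 C$, each of them output once. **Theorem.** There are absolute constants $a,b>0$ such that the following holds. Let $0\le q<p\le1$ and $0<\varepsilon\le a(p-q)$. Then there are $\gamma>0$ and $N\in\mathbb N$, depending only on $p,q,\varepsilon$, such that for every $c\ge \frac{b}{(p-q)\varepsilon}$, every $n\ge N$ and every partition $\mathcal C$ of $[n]$ that forms superclusters with parameters $(\varepsilon,c)$ with sizes $k_1,\dots,k_K$, the algorithm with parameters $p,q,\varepsilon,k_1,\dots,k_K$ recovers $\mathcal C$ from $\hat G\sim\mathcal G(n,\mathcal C,p,q)$ with probability at least $1-2^{-\gamma\sqrt n}$. -/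

import Mathlib

open scoped Matrix

namespace PlantedPartition

noncomputable section

/-! ## The planted partition model -/

/-- The probability with which the pair `e` is an edge: `p` if both endpoints lie in a common
cluster, and `q` otherwise. -/
def edgeProb {n : ℕ} (P : Finpartition (Finset.univ : Finset (Fin n))) (p q : ℝ)
    (e : Sym2 (Fin n)) : ℝ :=
  open scoped Classical in if ∃ C ∈ P.parts, ∀ u ∈ e, u ∈ C then p else q

/-- The law of a coin that is `True` with probability `r` and `False` with probability `1 - r`
(for `0 ≤ r ≤ 1`). -/
def coin (r : ℝ) : MeasureTheory.Measure Prop :=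
  ENNReal.ofReal r • MeasureTheory.Measure.dirac True +
    ENNReal.ofReal (1 - r) • MeasureTheory.Measure.dirac False

/-- The planted partition model `G(n, 𝒞, p, q)` as a law on graphs with vertex set `Fin n`:
independent coins are tossed for all unordered pairs, and the pairs `s(u, v)` with `u ≠ v` whose
coin shows `True` are the edges (`SimpleGraph.fromEdgeSet` ignores the diagonal pairs). -/
def model {n : ℕ} (P : Finpartition (Finset.univ : Finset (Fin n))) (p q : ℝ) :
    MeasureTheory.Measure (SimpleGraph (Fin n)) :=
  (MeasureTheory.Measure.pi fun e : Sym2 (Fin n) => coin (edgeProb P p q e)).map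
    fun ω => SimpleGraph.fromEdgeSet {e | ω e}

/-! ## Superclusters -/

/-- The clusters of `P` are grouped into nonempty superclusters `S 0, …, S (K - 1)`, listed in
decreasing order of their cluster sizes, with parameters `ε` and `c`. -/
structure IsSuperclustering {n : ℕ} (P : Finpartition (Finset.univ : Finset (Fin n))) {K : ℕ}
    (S : Fin K → Finset (Finset (Fin n))) (ε c : ℝ) : Prop where
  nonempty : ∀ i, (S i).Nonempty
  disjoint : ∀ i j, i ≠ j → Disjoint (S i) (S j)
  cover : ∀ C, C ∈ P.parts ↔ ∃ i, C ∈ S i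
  large : ∀ C ∈ P.parts, c * √(n : ℝ) ≤ (C.card : ℝ)
  separated : ∀ i j : Fin K, (i : ℕ) + 1 = j → ∀ C ∈ S i, ∀ D ∈ S j,
    (D.card : ℝ) + c * √(n : ℝ) ≤ (C.card : ℝ)
  within : ∀ i, ∀ C ∈ S i, ∀ D ∈ S i, (C.card : ℝ) ≤ (1 + ε) * (D.card : ℝ)

/-! ## Dominant eigenspaces and rank-`r` projectors -/

section Spectral

variable {V : Type*} [Fintype V] [DecidableEq V]

/-- An orthonormal basis of eigenvectors of `A`, listed in decreasing order of the eigenvalues.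
It exists for every symmetric `A`. The list of eigenvalues is determined by `A`; the eigenvectors
are not, and neither is the span of the first `r` of them if the `r`-th and the `(r+1)`-st
eigenvalue are equal. -/
structure OrderedEigenbasis (A : Matrix V V ℝ) where
  val : Fin (Fintype.card V) → ℝ
  vec : OrthonormalBasis (Fin (Fintype.card V)) ℝ (EuclideanSpace ℝ V)
  antitone_val : Antitone val
  mulVec_vec : ∀ i, A *ᵥ (vec i).ofLp = val i • (vec i).ofLp

variable {A : Matrix V V ℝ} (d : OrderedEigenbasis A)

/-- The largest eigenvalue. -/
def OrderedEigenbasis.top : ℝ := ⨆ i, d.val i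

/-- The dominant `r`-dimensional eigenspace. -/
def OrderedEigenbasis.dominantEigenspace (r : ℕ) : Submodule ℝ (EuclideanSpace ℝ V) :=
  Submodule.span ℝ (d.vec '' {i | (i : ℕ) < r})

/-- The rank-`r` projector: the matrix, in the standard basis, of the orthogonal projection onto
the dominant `r`-dimensional eigenspace. -/
def OrderedEigenbasis.projector (r : ℕ) : Matrix V V ℝ :=
  Matrix.of fun u v =>
    (d.dominantEigenspace r).starProjection (EuclideanSpace.single v (1 : ℝ)) u

end Spectral

/-! ## One iteration of the algorithm, on a graph `H` with vertex set `V` -/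

section Iteration

variable {V : Type*} [Fintype V] [DecidableEq V]

/-- The matrix `B̂ = Â + p I - q J`, where `Â` is the adjacency matrix of `H`. -/
def bHat (H : SimpleGraph V) (p q : ℝ) : Matrix V V ℝ :=
  open scoped Classical in
  H.adjMatrix ℝ + p • (1 : Matrix V V ℝ) - q • (Matrix.of fun _ _ => (1 : ℝ))

variable {H : SimpleGraph V} {p q : ℝ} (d : OrderedEigenbasis (bHat H p q))

/-- The size estimate `ŝ = (λ₁(B̂) + 7 √|V|) / (p - q)`. -/
def sHat : ℝ := (d.top + 7 * √(Fintype.card V : ℝ)) / (p - q)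

/-- The set `W_v` of the indices `u` of the entries `≥ 1 / (2 ŝ)` in column `v` of the rank-`r`
projector of `B̂`. -/
def largeEntries (r : ℕ) (v : V) : Finset V :=
  open scoped Classical in {u | 1 / (2 * sHat d) ≤ d.projector r u v}

/-- The Euclidean norm of the rank-`r` projector of `B̂` applied to the indicator vector of `W`. -/
def projNorm (r : ℕ) (W : Finset V) : ℝ :=
  ‖WithLp.toLp 2 (d.projector r *ᵥ fun u => if u ∈ W then (1 : ℝ) else 0)‖

/-- The columns `v` with `|W_v| ≤ (1 + ε) ŝ`. -/
def Admissible (ε : ℝ) (r : ℕ) (v : V) : Prop :=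
  ((largeEntries d r v).card : ℝ) ≤ (1 + ε) * sHat d

/-- `v` may be selected as `v*`: it is admissible and maximizes the norm of the projected
indicator vector of `W_v` among all admissible columns. -/
def IsPivot (ε : ℝ) (r : ℕ) (v : V) : Prop :=
  Admissible d ε r v ∧ ∀ w, Admissible d ε r w →
    projNorm d r (largeEntries d r w) ≤ projNorm d r (largeEntries d r v)

/-- The set of the vertices that have at least `(p - 10 ε) ŝ` neighbours in `W_v`. -/
def extracted (ε : ℝ) (r : ℕ) (v : V) : Finset V :=
  open scoped Classical in
  {u | (p - 10 * ε) * sHat d ≤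
    (((largeEntries d r v).filter fun w => H.Adj u w).card : ℝ)}

end Iteration

/-! ## The whole algorithm -/

section Algorithm

variable {V : Type*} [Fintype V] [DecidableEq V]

/-- `Run G p q ε U ks out`: the nonuniform iterated projection algorithm, run on the induced
subgraph `G[U]` with remaining supercluster sizes `ks`, can end with the result `out`, which is
the list of the extracted sets, or `none` if an iteration finds no admissible column.
The choices that the algorithm leaves open (the eigenvectors in case of a multiple eigenvalue, and
`v*` in case of a tie) can be made in any way. -/
inductive Run (G : SimpleGraph V) (p q ε : ℝ) :
    Finset V → List ℕ → Option (List (Finset V)) → Prop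
  | done (U : Finset V) : Run G p q ε U [] (some [])
  /-- The current supercluster is exhausted: go on with the next one. -/
  | next (U : Finset V) (ks : List ℕ) (out : Option (List (Finset V))) :
      Run G p q ε U ks out → Run G p q ε U (0 :: ks) out
  | fail (U : Finset V) (k : ℕ) (ks : List ℕ)
      (d : OrderedEigenbasis (bHat (G.induce (U : Set V)) p q)) :
      (∀ v, ¬ Admissible d ε (k + 1) v) → Run G p q ε U ((k + 1) :: ks) none
  /-- Extract a set, delete it and recurse. -/
  | extract (U : Finset V) (k : ℕ) (ks : List ℕ)
      (d : OrderedEigenbasis (bHat (G.induce (U : Set V)) p q)) (v : (U : Set V))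
      (C : Finset V) (out : Option (List (Finset V))) :
      IsPivot d ε (k + 1) v →
      C = (extracted d ε (k + 1) v).map (Function.Embedding.subtype _) →
      Run G p q ε (U \ C) (k :: ks) out →
      Run G p q ε U ((k + 1) :: ks) (out.map (List.cons C))

/-- The algorithm, started on `G` with supercluster sizes `ks`, ends, and however its open choices
are made, it returns exactly the parts of `P`, each of them once (in some order). -/
def Recovers (G : SimpleGraph V) (p q ε : ℝ) (ks : List ℕ)
    (P : Finpartition (Finset.univ : Finset V)) : Prop :=
  (∃ out, Run G p q ε Finset.univ ks out) ∧
    ∀ out, Run G p q ε Finset.univ ks out →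
      ∃ L : List (Finset V), out = some L ∧ (L : Multiset (Finset V)) = P.parts.val

end Algorithm

end

end PlantedPartition

/-!
# Iterated projection recovers nonuniform planted partitions

The proof separates a deterministic statement about *good* graphs from the estimate that the random
graph is good with overwhelming probability.

A graph is good (`IsGoodGraph`) if for every nonempty union `U` of clusters the matrix `B̂` of the
induced subgraph differs from its expectation by at most `7 √|U|` in operator norm, and if every
vertex has about the expected number of neighbours in every cluster. Requiring the spectral estimate
for all unions of clusters at once makes it irrelevant in which order the algorithm deletes the
clusters, and is affordable: there are at most `√n` clusters, hence at most `2 ^ √n` unions, while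
the estimate for a single union fails with probability at most `2 exp(-11 |U|)`, where `|U| ≥ √n`
(`measure_norm_noise_gt_le`). That bound follows from Hoeffding's inequality for the quadratic form
of the centred adjacency matrix on a `1/2`-net of the unit sphere with at most `5 ^ |U|` points.

On a good graph, let `T` be the current supercluster, with `k` clusters of sizes between `σ` and
`(1 + ε) σ`. The expectation of `B̂` acts on vectors that are constant on clusters as multiplication
by `(p - q) |C|` on the cluster `C`, so that the separation of the superclusters is a gap in its
spectrum. Weyl's inequality and a Davis–Kahan argument (`OrderedEigenbasis.projector_perturbation`)
show that the projector `P̂` onto the dominant eigenspace is within `ε / 500` of the projection `P`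
onto the span of the indicator vectors of the clusters in `T`, and that `‖P̂ - P‖²` is at most
`2k (ε / 1000)²` in the Frobenius norm. By averaging, some column of `P̂` is so close to that of `P`
that its large entries form a cluster up to few errors; this column is admissible and gives a
projected indicator vector of norm about `√σ` (`exists_admissible_long`). The pivot set `W` does at
least as well and has at most `(1 + ε) ŝ` elements, which by `‖P 1_W‖² = ∑ |W ∩ C|² / |C|` forces it
to contain nearly all of one cluster and little else (`exists_cluster_inter_large`). The degree
estimates then make the extracted set exactly this cluster (`IsTypical.extracted_eq_cluster`), and
induction over the remaining superclusters gives `run_correct`.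
-/

open scoped Matrix

namespace PlantedPartition

noncomputable section

set_option linter.unusedSectionVars false

open scoped Matrix.Norms.L2Operator

/-! ### Operator norms, and perturbation of spectral subspaces -/

section Norms

variable {V W : Type*} [Fintype V] [DecidableEq V] [Fintype W] [DecidableEq W]

lemma norm_toLp_mulVec_le (A : Matrix V V ℝ) (x : V → ℝ) :
    ‖WithLp.toLp 2 (A *ᵥ x)‖ ≤ ‖A‖ * ‖WithLp.toLp 2 x‖ :=
  A.l2_opNorm_mulVec (WithLp.toLp 2 x)

lemma norm_toLp_sq (x : V → ℝ) : ‖WithLp.toLp 2 x‖ ^ 2 = ∑ v, x v ^ 2 := by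
  simp [EuclideanSpace.norm_sq_eq]

lemma dotProduct_self_eq_norm_sq (x : V → ℝ) : x ⬝ᵥ x = ‖WithLp.toLp 2 x‖ ^ 2 := by
  rw [norm_toLp_sq]
  simp [dotProduct, sq]

lemma abs_dotProduct_le (x y : V → ℝ) : |x ⬝ᵥ y| ≤ ‖WithLp.toLp 2 x‖ * ‖WithLp.toLp 2 y‖ := by
  have := abs_real_inner_le_norm (WithLp.toLp 2 y) (WithLp.toLp 2 x)
  rw [EuclideanSpace.inner_eq_star_dotProduct] at this
  simpa [mul_comm] using this

lemma abs_quadForm_le (A : Matrix V V ℝ) (x : V → ℝ) : |x ⬝ᵥ A *ᵥ x| ≤ ‖A‖ * (x ⬝ᵥ x) := by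
  refine (abs_dotProduct_le _ _).trans ?_
  rw [dotProduct_self_eq_norm_sq]
  nlinarith [norm_toLp_mulVec_le A x, norm_nonneg (WithLp.toLp 2 x)]

lemma norm_diagonal_le {f : V → ℝ} {c : ℝ} (hc : 0 ≤ c) (h : ∀ i, |f i| ≤ c) :
    ‖(Matrix.diagonal f : Matrix V V ℝ)‖ ≤ c := by
  rw [Matrix.l2_opNorm_diagonal]
  exact (pi_norm_le_iff_of_nonneg hc).2 h

/-- Davis–Kahan in a normed ring: if `A` is invertible on the range of `P` with an inverse `Z` of
norm at most `1 / α`, and `B` acts with norm at most `β` on the range of the projection `Q`, then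
`Q P` is small, because `QP = QAZ = C(QP)Z + Q(A - B)Z`. -/
lemma norm_mul_le_of_spectral_gap {R : Type*} [NormedRing R] {A B P Q Z C : R} {α β ρ : ℝ}
    (hP : P = A * Z) (hZ : Z = P * Z) (hQ : Q * B = C * Q) (hQ1 : ‖Q‖ ≤ 1) (hC : ‖C‖ ≤ β)
    (hZ1 : ‖Z‖ * α ≤ 1) (hα : 0 < α) (hρ : ‖A - B‖ ≤ ρ) :
    ‖Q * P‖ * (α - β) ≤ ρ := by
  have h1 : Q * P = C * (Q * P) * Z + Q * (A - B) * Z := by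
    have : C * (Q * P) * Z = Q * B * Z := by
      rw [hQ, mul_assoc, mul_assoc, ← hZ, mul_assoc]
    rw [this, mul_sub, sub_mul, add_sub_cancel, mul_assoc, ← hP]
  have h2 : ‖Q * P‖ ≤ β * ‖Q * P‖ * ‖Z‖ + ρ * ‖Z‖ := by
    calc ‖Q * P‖ = ‖C * (Q * P) * Z + Q * (A - B) * Z‖ := congrArg _ h1
      _ ≤ ‖C‖ * ‖Q * P‖ * ‖Z‖ + ‖Q‖ * ‖A - B‖ * ‖Z‖ := by
        refine (norm_add_le _ _).trans (add_le_add ?_ ?_)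
        · exact (norm_mul_le _ _).trans (by gcongr; exact norm_mul_le _ _)
        · exact (norm_mul_le _ _).trans (by gcongr; exact norm_mul_le _ _)
      _ ≤ β * ‖Q * P‖ * ‖Z‖ + 1 * ρ * ‖Z‖ := by gcongr
      _ = _ := by ring
  have h0 := norm_nonneg (Q * P)
  have hβ : 0 ≤ β := (norm_nonneg _).trans hC
  have hρ0 : 0 ≤ ρ := (norm_nonneg _).trans hρ
  have h3 : α * ‖Q * P‖ ≤ (β * ‖Q * P‖ + ρ) * (‖Z‖ * α) := by
    nlinarith
  have h4 : (β * ‖Q * P‖ + ρ) * (‖Z‖ * α) ≤ β * ‖Q * P‖ + ρ :=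
    mul_le_of_le_one_right (by positivity) hZ1
  linarith

/-- A matrix supported on the range of the projection `R` has trace at most `‖Y‖` times the
rank of `R`. -/
lemma trace_le_of_projection {R Y : Matrix V V ℝ} (hR : IsStarProjection R) (hY : Y = R * Y * R) :
    Y.trace ≤ ‖Y‖ * R.trace := by
  have hT : Rᵀ = R := by simpa [Matrix.star_eq_conjTranspose] using hR.isSelfAdjoint.star_eq
  have hRR : R * R = R := hR.isIdempotentElem
  have key : ∀ v, Y v v ≤ ‖Y‖ * R v v := by
    intro v
    have h1 := abs_quadForm_le Y (fun u => R u v)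
    have h2 : (fun u => R u v) ⬝ᵥ (fun u => R u v) = R v v := by
      conv_rhs => rw [← hRR]
      conv_lhs => rw [← hT]
      rw [Matrix.mul_apply]
      simp [dotProduct, Matrix.transpose_apply]
      refine Finset.sum_congr rfl fun u _ => ?_
      have : R u v = R v u := congrFun (congrFun hT v) u
      rw [this]
    have h3 : (fun u => R u v) ⬝ᵥ Y *ᵥ (fun u => R u v) = Y v v := by
      conv_rhs => rw [hY, mul_assoc, Matrix.mul_apply]
      simp only [dotProduct]
      refine Finset.sum_congr rfl fun u _ => ?_
      have : R u v = R v u := congrFun (congrFun hT v) u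
      rw [this]
      rfl
    rw [h2, h3] at h1
    exact (le_abs_self _).trans h1
  rw [Matrix.trace, Matrix.trace, Finset.mul_sum]
  exact Finset.sum_le_sum fun v _ => key v

end Norms

section Projections

variable {V : Type*} [Fintype V] [DecidableEq V]

/-- Two projections are close in norm if the complement of each nearly annihilates the range of the
other, because `R - P = R (1 - P) - (1 - R) P`. -/
lemma norm_projection_sub_le {P R : Matrix V V ℝ} (hP : IsStarProjection P)
    (hR : IsStarProjection R) {η : ℝ} (h1 : ‖(1 - P) * R‖ ≤ η) (h2 : ‖(1 - R) * P‖ ≤ η) :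
    ‖R - P‖ ≤ 2 * η := by
  have h3 : R * (1 - P) = star ((1 - P) * R) := by
    rw [star_mul, hR.isSelfAdjoint.star_eq, hP.one_sub.isSelfAdjoint.star_eq]
  have h4 : R - P = R * (1 - P) - (1 - R) * P := by noncomm_ring
  rw [h4, h3]
  refine (norm_sub_le _ _).trans ?_
  rw [norm_star]
  linarith

/-- The squared Frobenius distance of two projections is controlled by their ranks and by the
operator norms of `(1 - P) R` and `(1 - R) P`. -/
lemma sum_sq_projection_sub_le {P R : Matrix V V ℝ} (hP : IsStarProjection P)
    (hR : IsStarProjection R) {η k : ℝ} (h1 : ‖(1 - P) * R‖ ≤ η) (h2 : ‖(1 - R) * P‖ ≤ η)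
    (hPk : P.trace ≤ k) (hRk : R.trace ≤ k) (hk : 0 ≤ k) :
    ∑ v, ∑ u, (R u v - P u v) ^ 2 ≤ 2 * k * η ^ 2 := by
  have aux : ∀ {P R : Matrix V V ℝ}, IsStarProjection P → IsStarProjection R →
      ‖(1 - P) * R‖ ≤ η → R.trace ≤ k → (R * (1 - P) * R).trace ≤ η ^ 2 * k := by
    intro P R hP hR h1 hRk
    have hY : R * (1 - P) * R = star ((1 - P) * R) * ((1 - P) * R) := by
      rw [star_mul, hR.isSelfAdjoint.star_eq, hP.one_sub.isSelfAdjoint.star_eq, mul_assoc,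
        mul_assoc, ← mul_assoc (1 - P) (1 - P), hP.one_sub.isIdempotentElem.eq]
    have hn : ‖R * (1 - P) * R‖ ≤ η ^ 2 := by
      rw [hY, CStarRing.norm_star_mul_self, sq]
      exact mul_le_mul h1 h1 (norm_nonneg _) ((norm_nonneg _).trans h1)
    have ht := trace_le_of_projection (R := R) (Y := R * (1 - P) * R) hR (by
      have := hR.isIdempotentElem.eq
      calc R * (1 - P) * R = (R * R) * (1 - P) * (R * R) := by rw [this]
        _ = _ := by noncomm_ring)
    refine ht.trans ?_
    calc ‖R * (1 - P) * R‖ * R.trace ≤ ‖R * (1 - P) * R‖ * k := by gcongr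
      _ ≤ η ^ 2 * k := by gcongr
  have e : ∑ v, ∑ u, (R u v - P u v) ^ 2 = ((R - P) * (R - P)).trace := by
    have hT : (R - P)ᵀ = R - P := by
      simpa [Matrix.star_eq_conjTranspose] using
        (hR.isSelfAdjoint.sub hP.isSelfAdjoint).star_eq
    have h : (R - P) * (R - P) = (R - P)ᵀ * (R - P) := by rw [hT]
    rw [h]
    simp [Matrix.trace, Matrix.mul_apply, sq]
  have e2 : ((R - P) * (R - P)).trace = (R * (1 - P) * R).trace + (P * (1 - R) * P).trace := by
    have r1 := hR.isIdempotentElem.eq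
    have p1 := hP.isIdempotentElem.eq
    have t1 : (R * (1 - P) * R).trace = R.trace - (R * P).trace := by
      rw [Matrix.trace_mul_comm, ← mul_assoc, r1, mul_sub, mul_one, Matrix.trace_sub]
    have t2 : (P * (1 - R) * P).trace = P.trace - (R * P).trace := by
      rw [Matrix.trace_mul_comm, ← mul_assoc, p1, mul_sub, mul_one, Matrix.trace_sub,
        Matrix.trace_mul_comm P R]
    rw [t1, t2, sub_mul, mul_sub, mul_sub, r1, p1]
    simp only [Matrix.trace_sub]
    rw [Matrix.trace_mul_comm P R]
    ring
  rw [e, e2]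
  have := aux hP hR h1 hRk
  have := aux hR hP h2 hPk
  linarith

end Projections

/-! ### Functional calculus of an ordered eigenbasis -/

section Calculus

variable {V : Type*} [Fintype V] [DecidableEq V] {A : Matrix V V ℝ} (d : OrderedEigenbasis A)

/-- The orthogonal matrix whose columns are the eigenvectors. -/
def OrderedEigenbasis.vecMatrix : Matrix V (Fin (Fintype.card V)) ℝ :=
  Matrix.of fun u i => d.vec i u

/-- The functional calculus of `A`: the matrix with the eigenvectors of `d` and the eigenvalues
`f`. -/
def OrderedEigenbasis.fn (f : Fin (Fintype.card V) → ℝ) : Matrix V V ℝ :=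
  d.vecMatrix * Matrix.diagonal f * d.vecMatrixᵀ

lemma OrderedEigenbasis.vec_dotProduct (i j : Fin (Fintype.card V)) :
    (d.vec i).ofLp ⬝ᵥ (d.vec j).ofLp = if i = j then 1 else 0 := by
  have := (orthonormal_iff_ite.1 d.vec.orthonormal) j i
  rw [EuclideanSpace.inner_eq_star_dotProduct] at this
  simpa [eq_comm] using this

lemma OrderedEigenbasis.transpose_mul_vecMatrix : d.vecMatrixᵀ * d.vecMatrix = 1 := by
  ext i j
  have := d.vec_dotProduct i j
  rw [Matrix.one_apply, ← this]
  rfl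

lemma OrderedEigenbasis.vecMatrix_mul_transpose : d.vecMatrix * d.vecMatrixᵀ = 1 :=
  (Matrix.mul_eq_one_comm_of_card_eq _ _ _ (by simp)).1 d.transpose_mul_vecMatrix

lemma OrderedEigenbasis.norm_vecMatrix_le : ‖d.vecMatrix‖ ≤ 1 := by
  have h := Matrix.l2_opNorm_conjTranspose_mul_self d.vecMatrix
  have h1 : ‖(1 : Matrix (Fin (Fintype.card V)) (Fin (Fintype.card V)) ℝ)‖ ≤ 1 := by
    rw [← Matrix.diagonal_one]
    exact norm_diagonal_le zero_le_one (by simp)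
  rw [Matrix.conjTranspose_eq_transpose_of_trivial, d.transpose_mul_vecMatrix] at h
  nlinarith [norm_nonneg d.vecMatrix]

lemma OrderedEigenbasis.norm_fn_le {f : Fin (Fintype.card V) → ℝ} {c : ℝ} (hc : 0 ≤ c)
    (h : ∀ i, |f i| ≤ c) : ‖d.fn f‖ ≤ c := by
  have h1 := d.norm_vecMatrix_le
  have h2 : ‖d.vecMatrixᵀ‖ ≤ 1 := by
    rw [← Matrix.conjTranspose_eq_transpose_of_trivial, Matrix.l2_opNorm_conjTranspose]
    exact h1
  calc ‖d.fn f‖ ≤ ‖d.vecMatrix * Matrix.diagonal f‖ * ‖d.vecMatrixᵀ‖ := Matrix.l2_opNorm_mul _ _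
    _ ≤ (‖d.vecMatrix‖ * ‖(Matrix.diagonal f : Matrix _ _ ℝ)‖) * ‖d.vecMatrixᵀ‖ := by
      gcongr; exact Matrix.l2_opNorm_mul _ _
    _ ≤ (1 * c) * 1 := by
      gcongr
      exact norm_diagonal_le hc h
    _ = c := by ring

lemma OrderedEigenbasis.fn_mul_fn (f g : Fin (Fintype.card V) → ℝ) :
    d.fn f * d.fn g = d.fn (f * g) := by
  have : d.fn f * d.fn g = d.vecMatrix * Matrix.diagonal f * (d.vecMatrixᵀ * d.vecMatrix) *
      Matrix.diagonal g * d.vecMatrixᵀ := by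
    simp only [fn, Matrix.mul_assoc]
  rw [this, d.transpose_mul_vecMatrix, Matrix.mul_one, Matrix.mul_assoc d.vecMatrix,
    Matrix.diagonal_mul_diagonal]
  rfl

lemma OrderedEigenbasis.fn_one : d.fn 1 = 1 := by
  have : (Matrix.diagonal 1 : Matrix (Fin (Fintype.card V)) (Fin (Fintype.card V)) ℝ) = 1 :=
    Matrix.diagonal_one
  rw [fn, this, Matrix.mul_one, d.vecMatrix_mul_transpose]

lemma OrderedEigenbasis.fn_sub (f g : Fin (Fintype.card V) → ℝ) :
    d.fn (f - g) = d.fn f - d.fn g := by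
  have : (Matrix.diagonal (f - g) : Matrix (Fin (Fintype.card V)) (Fin (Fintype.card V)) ℝ) =
    Matrix.diagonal f - Matrix.diagonal g := (Matrix.diagonal_sub f g).symm
  rw [fn, this, Matrix.mul_sub, Matrix.sub_mul]
  rfl

lemma OrderedEigenbasis.star_fn (f : Fin (Fintype.card V) → ℝ) : star (d.fn f) = d.fn f := by
  simp [fn, Matrix.star_eq_conjTranspose, Matrix.mul_assoc]

lemma OrderedEigenbasis.eq_fn_val : A = d.fn d.val := by
  have h : A * d.vecMatrix = d.vecMatrix * Matrix.diagonal d.val := by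
    ext u i
    have := congrFun (d.mulVec_vec i) u
    rw [Matrix.mul_diagonal]
    simpa [Matrix.mulVec, Matrix.mul_apply, vecMatrix, dotProduct, mul_comm] using this
  rw [fn, ← h, Matrix.mul_assoc, d.vecMatrix_mul_transpose, Matrix.mul_one]

lemma OrderedEigenbasis.fn_apply (f : Fin (Fintype.card V) → ℝ) (u v : V) :
    d.fn f u v = ∑ i, f i * d.vec i u * d.vec i v := by
  rw [fn, Matrix.mul_apply]
  refine Finset.sum_congr rfl fun i _ => ?_
  rw [Matrix.mul_diagonal]
  simp [vecMatrix, mul_comm]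

/-- The projector is the spectral projection of the first `r` eigenvalues. -/
lemma OrderedEigenbasis.projector_eq_fn (r : ℕ) :
    d.projector r = d.fn fun i => if (i : ℕ) < r then 1 else 0 := by
  have key : ∀ x : EuclideanSpace ℝ V, (d.dominantEigenspace r).starProjection x =
      ∑ i : Fin (Fintype.card V), if (i : ℕ) < r then inner ℝ (d.vec i) x • d.vec i else 0 := by
    intro x
    refine Submodule.eq_starProjection_of_mem_of_inner_eq_zero (K := d.dominantEigenspace r) ?_ ?_
    · refine Submodule.sum_mem _ fun i _ => ?_
      split_ifs with h
      · exact Submodule.smul_mem _ _ (Submodule.subset_span ⟨i, h, rfl⟩)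
      · exact Submodule.zero_mem _
    · intro w hw
      induction hw using Submodule.span_induction with
      | mem y hy =>
        obtain ⟨j, hj, rfl⟩ := hy
        have hj' : (j : ℕ) < r := hj
        rw [inner_sub_left, sum_inner]
        have h2 : ∀ i : Fin (Fintype.card V), inner ℝ
            (if (i : ℕ) < r then inner ℝ (d.vec i) x • d.vec i else 0) (d.vec j) =
            if i = j then inner ℝ (d.vec j) x else 0 := by
          intro i
          by_cases hij : i = j
          · subst hij
            simp [hj', inner_smul_left]
          · split_ifs with h
            · simp [inner_smul_left, d.vec.inner_eq_zero hij]
            · simp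
        simp only [h2, Finset.sum_ite_eq', Finset.mem_univ, if_true]
        rw [real_inner_comm, sub_self]
      | zero => simp
      | add y z _ _ hy hz => rw [inner_add_right, hy, hz, add_zero]
      | smul a y _ hy => rw [inner_smul_right, hy, mul_zero]
  ext u v
  rw [fn_apply, projector, Matrix.of_apply, key]
  simp only [WithLp.ofLp_sum, Finset.sum_apply]
  refine Finset.sum_congr rfl fun i _ => ?_
  split_ifs with h
  · simp [EuclideanSpace.inner_single_right, mul_comm]
  · simp

lemma OrderedEigenbasis.isStarProjection_projector (r : ℕ) :
    IsStarProjection (d.projector r) := by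
  rw [d.projector_eq_fn]
  refine ⟨?_, d.star_fn _⟩
  rw [IsIdempotentElem, d.fn_mul_fn]
  congr 1
  ext i
  simp

lemma OrderedEigenbasis.trace_projector_le (r : ℕ) : (d.projector r).trace ≤ r := by
  rw [d.projector_eq_fn, fn, Matrix.trace_mul_comm, ← Matrix.mul_assoc, d.transpose_mul_vecMatrix,
    Matrix.one_mul, Matrix.trace_diagonal, Finset.sum_boole]
  norm_cast
  calc _ ≤ (Finset.range r).card := by
        refine Finset.card_le_card_of_injOn (fun i => (i : ℕ)) ?_ ?_
        · intro i hi; simpa using hi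
        · intro i _ j _ h; exact Fin.ext h
    _ = r := by simp

end Calculus

/-! ### Block-constant matrices -/

section ClusterMatrices

variable {V ι : Type*} [Fintype V] [DecidableEq V] [DecidableEq ι] (cl : V → ι)

/-- The cluster with label `C` of the clustering given by the label map `cl`. -/
def cluster (C : ι) : Finset V := Finset.univ.filter fun v => cl v = C

@[simp] lemma mem_cluster {cl : V → ι} {C : ι} {v : V} : v ∈ cluster cl C ↔ cl v = C := by
  simp [cluster]

lemma card_cluster_pos (v : V) : (0 : ℝ) < (cluster cl (cl v)).card := by
  exact_mod_cast Finset.card_pos.2 ⟨v, by simp⟩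

/-- The block-diagonal matrix that acts on vectors constant on the clusters as multiplication by
`w C` on the cluster `C`, and annihilates the orthogonal complement of those vectors. -/
def clusterMatrix (w : ι → ℝ) : Matrix V V ℝ :=
  Matrix.of fun u v => if cl u = cl v then w (cl u) / (cluster cl (cl u)).card else 0

lemma clusterMatrix_apply (w : ι → ℝ) (u v : V) : clusterMatrix cl w u v =
    if cl u = cl v then w (cl u) / (cluster cl (cl u)).card else 0 := rfl

lemma clusterMatrix_mul (w w' : ι → ℝ) :
    clusterMatrix cl w * clusterMatrix cl w' = clusterMatrix cl (w * w') := by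
  ext u v
  simp only [Matrix.mul_apply, clusterMatrix_apply, Pi.mul_apply]
  have h : ∀ x, ((if cl u = cl x then w (cl u) / (cluster cl (cl u)).card else 0) *
      (if cl x = cl v then w' (cl x) / (cluster cl (cl x)).card else 0) : ℝ) =
      if x ∈ cluster cl (cl u) then
        (if cl u = cl v then w (cl u) * w' (cl u) / ((cluster cl (cl u)).card) ^ 2 else 0)
      else 0 := by
    intro x
    by_cases h1 : cl u = cl x
    · simp only [h1, mem_cluster, if_true]
      by_cases h2 : cl x = cl v
      · simp only [h2, if_true]; ring
      · simp [h2]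
    · have : ¬ cl x = cl u := fun h => h1 h.symm
      simp [h1, this]
  simp only [h]
  rw [Finset.sum_ite_mem, Finset.univ_inter, Finset.sum_const, nsmul_eq_mul]
  have := (card_cluster_pos cl u).ne'
  split_ifs
  · field_simp
  · simp

lemma star_clusterMatrix (w : ι → ℝ) : star (clusterMatrix cl w) = clusterMatrix cl w := by
  ext u v
  simp only [Matrix.star_apply, clusterMatrix_apply, star_trivial]
  by_cases h : cl u = cl v
  · simp [h]
  · simp [h, Ne.symm h]

lemma clusterMatrix_sub (w w' : ι → ℝ) :
    clusterMatrix cl w - clusterMatrix cl w' = clusterMatrix cl (w - w') := by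
  ext u v
  simp only [Matrix.sub_apply, clusterMatrix_apply, Pi.sub_apply]
  split_ifs
  · ring
  · simp

lemma norm_clusterMatrix_le {w : ι → ℝ} {c : ℝ} (hc : 0 ≤ c) (h : ∀ C, |w C| ≤ c) :
    ‖clusterMatrix cl w‖ ≤ c := by
  have h1 : ‖clusterMatrix cl 1‖ ≤ 1 := by
    refine IsStarProjection.norm_le _ ⟨?_, star_clusterMatrix cl 1⟩
    rw [IsIdempotentElem, clusterMatrix_mul, mul_one]
  have h2 : clusterMatrix cl w = clusterMatrix cl 1 * Matrix.diagonal fun v => w (cl v) := by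
    ext u v
    rw [Matrix.mul_diagonal]
    simp only [clusterMatrix_apply, Pi.one_apply]
    split_ifs with h
    · rw [h]; ring
    · simp
  rw [h2]
  refine (norm_mul_le _ _).trans ?_
  calc _ ≤ 1 * c := by
        gcongr
        exact norm_diagonal_le hc fun v => h _
    _ = c := one_mul c

/-- The orthogonal projection onto the span of the indicator vectors of the clusters with labels
in `T`. -/
def clusterProjection (T : Finset ι) : Matrix V V ℝ :=
  clusterMatrix cl fun C => if C ∈ T then 1 else 0

lemma isStarProjection_clusterProjection (T : Finset ι) :
    IsStarProjection (clusterProjection cl T) := by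
  refine ⟨?_, star_clusterMatrix cl _⟩
  rw [IsIdempotentElem, clusterProjection, clusterMatrix_mul]
  congr 1
  ext C
  simp

lemma trace_clusterProjection_le (T : Finset ι) : (clusterProjection cl T).trace ≤ T.card := by
  have h : (clusterProjection cl T).trace =
      ∑ v : V, ∑ C ∈ T, if cl v = C then 1 / ((cluster cl C).card : ℝ) else 0 := by
    rw [Matrix.trace]
    refine Finset.sum_congr rfl fun v _ => ?_
    rw [Finset.sum_ite_eq]
    simp only [Matrix.diag_apply, clusterProjection, clusterMatrix_apply, if_true]
    split_ifs <;> simp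
  rw [h, Finset.sum_comm]
  calc _ ≤ ∑ C ∈ T, (1 : ℝ) := by
        refine Finset.sum_le_sum fun C _ => ?_
        rw [← Finset.sum_filter, Finset.sum_const, nsmul_eq_mul]
        change ((cluster cl C).card : ℝ) * _ ≤ 1
        rw [mul_one_div]
        exact div_self_le_one _
    _ = T.card := by simp

/-- A vector that is constant on clusters is acted upon by multiplication. -/
lemma clusterMatrix_mulVec_comp (w a : ι → ℝ) :
    clusterMatrix cl w *ᵥ (fun v => a (cl v)) = fun v => w (cl v) * a (cl v) := by
  ext v
  have h : ∀ u, clusterMatrix cl w v u * a (cl u) =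
      if u ∈ cluster cl (cl v) then w (cl v) * a (cl v) / (cluster cl (cl v)).card else 0 := by
    intro u
    simp only [clusterMatrix_apply, mem_cluster]
    by_cases h : cl v = cl u
    · simp only [h, if_true]; ring
    · simp [h, Ne.symm h]
  simp only [Matrix.mulVec, dotProduct, h]
  rw [Finset.sum_ite_mem, Finset.univ_inter, Finset.sum_const, nsmul_eq_mul]
  have := (card_cluster_pos cl v).ne'
  field_simp

lemma clusterMatrix_mulVec (w : ι → ℝ) (x : V → ℝ) (v : V) : (clusterMatrix cl w *ᵥ x) v =
    w (cl v) / (cluster cl (cl v)).card * ∑ u ∈ cluster cl (cl v), x u := by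
  simp only [Matrix.mulVec, dotProduct, clusterMatrix_apply, ite_mul, zero_mul, cluster]
  rw [← Finset.sum_filter, Finset.mul_sum]
  simp only [eq_comm]

lemma quadForm_clusterMatrix_nonneg {w : ι → ℝ} (hw : ∀ C, 0 ≤ w C) (x : V → ℝ) :
    0 ≤ x ⬝ᵥ clusterMatrix cl w *ᵥ x := by
  have h : clusterMatrix cl w =
      (clusterMatrix cl fun C => √(w C))ᵀ * clusterMatrix cl fun C => √(w C) := by
    have : (clusterMatrix cl fun C => √(w C))ᵀ = clusterMatrix cl fun C => √(w C) := by
      simpa [Matrix.star_eq_conjTranspose] using star_clusterMatrix cl fun C => √(w C)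
    rw [this, clusterMatrix_mul]
    congr 1
    ext C
    simp [Real.mul_self_sqrt (hw C)]
  rw [h, ← Matrix.mulVec_mulVec, Matrix.dotProduct_mulVec, Matrix.vecMul_transpose,
    dotProduct_self_eq_norm_sq]
  positivity

end ClusterMatrices

/-! ### Eigenvalues and dominant eigenspaces of perturbed block-constant matrices -/

section Weyl

variable {V ι : Type*} [Fintype V] [DecidableEq V] [DecidableEq ι] {cl : V → ι}
  {A : Matrix V V ℝ} (d : OrderedEigenbasis A)

lemma OrderedEigenbasis.quadForm_fn (f : Fin (Fintype.card V) → ℝ) (x : V → ℝ) :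
    x ⬝ᵥ d.fn f *ᵥ x = ∑ i, f i * ((d.vec i).ofLp ⬝ᵥ x) ^ 2 := by
  have h : d.vecMatrixᵀ *ᵥ x = fun i => (d.vec i).ofLp ⬝ᵥ x := by
    ext i
    rfl
  rw [fn, ← Matrix.mulVec_mulVec, ← Matrix.mulVec_mulVec, Matrix.dotProduct_mulVec,
    ← Matrix.mulVec_transpose, h]
  simp only [dotProduct, Matrix.mulVec_diagonal]
  refine Finset.sum_congr rfl fun i _ => ?_
  ring

lemma OrderedEigenbasis.quadForm_eq (x : V → ℝ) :
    x ⬝ᵥ A *ᵥ x = ∑ i, d.val i * ((d.vec i).ofLp ⬝ᵥ x) ^ 2 := by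
  rw [← d.quadForm_fn, ← d.eq_fn_val]

lemma OrderedEigenbasis.dotProduct_self_eq (x : V → ℝ) :
    x ⬝ᵥ x = ∑ i, ((d.vec i).ofLp ⬝ᵥ x) ^ 2 := by
  have := d.quadForm_fn 1 x
  rw [d.fn_one, Matrix.one_mulVec] at this
  simpa using this

lemma OrderedEigenbasis.val_eq_quadForm (i : Fin (Fintype.card V)) :
    d.val i = (d.vec i).ofLp ⬝ᵥ A *ᵥ (d.vec i).ofLp := by
  rw [d.mulVec_vec, dotProduct_smul, d.vec_dotProduct]
  simp

lemma dotProduct_self_pos {x : V → ℝ} (hx : x ≠ 0) : 0 < x ⬝ᵥ x := by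
  have h : 0 ≤ x ⬝ᵥ x := by rw [dotProduct_self_eq_norm_sq]; positivity
  exact lt_of_le_of_ne h fun h0 => hx (dotProduct_self_eq_zero.1 h0.symm)

lemma quadForm_sub_le {A B : Matrix V V ℝ} {ρ : ℝ} (h : ‖A - B‖ ≤ ρ) (x : V → ℝ) :
    |x ⬝ᵥ A *ᵥ x - x ⬝ᵥ B *ᵥ x| ≤ ρ * (x ⬝ᵥ x) := by
  rw [← dotProduct_sub, ← Matrix.sub_mulVec]
  refine (abs_quadForm_le _ _).trans ?_
  have : 0 ≤ x ⬝ᵥ x := by rw [dotProduct_self_eq_norm_sq]; positivity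
  gcongr

/-- Weyl's inequality for the leading eigenvalues of a perturbed cluster matrix. -/
lemma OrderedEigenbasis.le_val_of_lt_card {T : Finset ι} {w : ι → ℝ} {α ρ : ℝ}
    (hρ : ‖A - clusterMatrix cl w‖ ≤ ρ) (hT : ∀ C ∈ T, (cluster cl C).Nonempty)
    (hα : ∀ C ∈ T, α ≤ w C) (i : Fin (Fintype.card V)) (hi : (i : ℕ) < T.card) :
    α - ρ ≤ d.val i := by
  -- A nonzero combination of the indicator vectors orthogonal to the first `i` eigenvectors.
  let ext : (T → ℝ) →ₗ[ℝ] (V → ℝ) :=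
    { toFun := fun a v => if h : cl v ∈ T then a ⟨cl v, h⟩ else 0
      map_add' := by intro a b; ext v; simp only [Pi.add_apply]; split_ifs <;> simp
      map_smul' := by intro r a; ext v; simp }
  let φ : (T → ℝ) →ₗ[ℝ] (Fin i → ℝ) :=
    { toFun := fun a j => (d.vec ⟨j, j.2.trans i.2⟩).ofLp ⬝ᵥ ext a
      map_add' := by intro a b; ext j; simp [dotProduct_add]
      map_smul' := by intro r a; ext j; simp [dotProduct_smul] }
  have hker := LinearMap.ker_ne_bot_of_finrank_lt (f := φ) (by simpa using hi)
  obtain ⟨a, ha, ha0⟩ := (Submodule.ne_bot_iff _).1 hker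
  have hx0 : ext a ≠ 0 := by
    intro h
    apply ha0
    ext C
    obtain ⟨v, hv⟩ := hT C C.2
    have hv' : cl v = C := mem_cluster.1 hv
    have := congrFun h v
    have h3 : ext a v = a C := by
      change (if h : cl v ∈ T then a ⟨cl v, h⟩ else 0) = _
      rw [dif_pos (by rw [hv']; exact C.2)]
      congr 1
      exact Subtype.ext hv'
    rw [← h3, this]
    rfl
  have horth : ∀ j : Fin (Fintype.card V), j < i → (d.vec j).ofLp ⬝ᵥ ext a = 0 := by
    intro j hj
    exact congrFun (LinearMap.mem_ker.1 ha) ⟨j, hj⟩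
  set x := ext a
  have hpos := dotProduct_self_pos hx0
  have h1 : x ⬝ᵥ A *ᵥ x ≤ d.val i * (x ⬝ᵥ x) := by
    rw [d.quadForm_eq, d.dotProduct_self_eq, Finset.mul_sum]
    refine Finset.sum_le_sum fun j _ => ?_
    by_cases hj : j < i
    · rw [horth j hj]; simp
    · have := d.antitone_val (not_lt.1 hj)
      gcongr
  have h2 : α * (x ⬝ᵥ x) ≤ x ⬝ᵥ clusterMatrix cl w *ᵥ x := by
    have hx : x = fun v => (fun C => if h : C ∈ T then a ⟨C, h⟩ else 0) (cl v) := rfl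
    have hB : clusterMatrix cl w *ᵥ x = fun v => w (cl v) * x v :=
      clusterMatrix_mulVec_comp cl w fun C => if h : C ∈ T then a ⟨C, h⟩ else 0
    rw [hB]
    simp only [dotProduct]
    rw [Finset.mul_sum]
    refine Finset.sum_le_sum fun v _ => ?_
    by_cases h : cl v ∈ T
    · nlinarith [hα _ h, mul_self_nonneg (x v)]
    · have : x v = 0 := by rw [hx]; simp [h]
      simp [this]
  have h3 := abs_le.1 (quadForm_sub_le hρ x)
  have h4 : (α - ρ) * (x ⬝ᵥ x) ≤ d.val i * (x ⬝ᵥ x) := by linarith [h3.1]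
  exact le_of_mul_le_mul_right h4 hpos

/-- Weyl's inequality for the remaining eigenvalues of a perturbed cluster matrix. -/
lemma OrderedEigenbasis.val_le_of_card_le {T : Finset ι} {w : ι → ℝ} {β ρ : ℝ} (hβ0 : 0 ≤ β)
    (hρ : ‖A - clusterMatrix cl w‖ ≤ ρ)
    (hβ : ∀ C, C ∉ T → |w C| ≤ β) (i : Fin (Fintype.card V)) (hi : T.card ≤ (i : ℕ)) :
    d.val i ≤ β + ρ := by
  -- A nonzero vector in the span of the first `i + 1` eigenvectors with zero sum on each cluster.
  let φ : (V → ℝ) →ₗ[ℝ] ((T → ℝ) × (Finset.Ioi i → ℝ)) :=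
    { toFun := fun x => (fun C => ∑ v ∈ cluster cl C, x v, fun j => (d.vec j).ofLp ⬝ᵥ x)
      map_add' := by
        intro x y
        ext j
        · simp [Finset.sum_add_distrib]
        · simp [dotProduct_add]
      map_smul' := by
        intro r x
        ext j
        · simp [Finset.mul_sum]
        · simp [dotProduct_smul] }
  have hker := LinearMap.ker_ne_bot_of_finrank_lt (f := φ) (by
    simp only [Module.finrank_prod, Module.finrank_fintype_fun_eq_card, Fintype.card_coe,
      Fin.card_Ioi]
    have := i.2
    omega)
  obtain ⟨x, hx, hx0⟩ := (Submodule.ne_bot_iff _).1 hker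
  have hx := LinearMap.mem_ker.1 hx
  have hsum : ∀ C ∈ T, ∑ v ∈ cluster cl C, x v = 0 := fun C hC =>
    congrFun (congrArg Prod.fst hx) ⟨C, hC⟩
  have horth : ∀ j, i < j → (d.vec j).ofLp ⬝ᵥ x = 0 := fun j hj =>
    congrFun (congrArg Prod.snd hx) ⟨j, Finset.mem_Ioi.2 hj⟩
  have hpos := dotProduct_self_pos hx0
  have h1 : d.val i * (x ⬝ᵥ x) ≤ x ⬝ᵥ A *ᵥ x := by
    rw [d.quadForm_eq, d.dotProduct_self_eq, Finset.mul_sum]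
    refine Finset.sum_le_sum fun j _ => ?_
    by_cases hj : i < j
    · rw [horth j hj]; simp
    · have := d.antitone_val (not_lt.1 hj)
      gcongr
  have h2 : x ⬝ᵥ clusterMatrix cl w *ᵥ x ≤ β * (x ⬝ᵥ x) := by
    have hB : clusterMatrix cl w *ᵥ x =
        clusterMatrix cl (fun C => if C ∈ T then 0 else w C) *ᵥ x := by
      ext v
      rw [clusterMatrix_mulVec, clusterMatrix_mulVec]
      by_cases h : cl v ∈ T
      · rw [hsum _ h]; simp
      · simp [h]
    rw [hB]
    refine (le_abs_self _).trans ((abs_quadForm_le _ _).trans ?_)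
    gcongr
    refine norm_clusterMatrix_le cl hβ0 fun C => ?_
    split_ifs with h
    · simpa using hβ0
    · exact hβ C h
  have h3 := abs_le.1 (quadForm_sub_le hρ x)
  have h4 : d.val i * (x ⬝ᵥ x) ≤ (β + ρ) * (x ⬝ᵥ x) := by linarith [h3.2]
  exact le_of_mul_le_mul_right h4 hpos

/-- The Davis–Kahan estimates for a perturbed cluster matrix: the dominant eigenspace of `A` is
close to the span of the indicator vectors of the clusters in `T`. -/
lemma OrderedEigenbasis.projector_perturbation {T : Finset ι} {w : ι → ℝ} {α β ρ : ℝ}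
    (hβ0 : 0 ≤ β) (hρ : ‖A - clusterMatrix cl w‖ ≤ ρ)
    (hT : ∀ C ∈ T, (cluster cl C).Nonempty) (hα : ∀ C ∈ T, α ≤ w C)
    (hw : ∀ C, 0 ≤ w C) (hβ : ∀ C, C ∉ T → w C ≤ β) (hgap : ρ < α) :
    ‖(1 - clusterProjection cl T) * d.projector T.card‖ * (α - β - ρ) ≤ ρ ∧
    ‖(1 - d.projector T.card) * clusterProjection cl T‖ * (α - β - ρ) ≤ ρ := by
  have hρ0 : 0 ≤ ρ := (norm_nonneg _).trans hρ
  have hβ' : ∀ C, C ∉ T → |w C| ≤ β := fun C hC => by rw [abs_of_nonneg (hw C)]; exact hβ C hC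
  have hlow := d.le_val_of_lt_card hρ hT hα
  have hup := d.val_le_of_card_le hβ0 hρ hβ'
  have hneg : ∀ i, -ρ ≤ d.val i := by
    intro i
    have h1 := abs_le.1 (quadForm_sub_le hρ (d.vec i).ofLp)
    have h2 := quadForm_clusterMatrix_nonneg cl hw (d.vec i).ofLp
    rw [← d.val_eq_quadForm, d.vec_dotProduct] at h1
    simp only [if_true, mul_one] at h1
    linarith [h1.1]
  have hα0 : 0 < α := lt_of_le_of_lt hρ0 hgap
  constructor
  · have h := norm_mul_le_of_spectral_gap (A := A) (B := clusterMatrix cl w)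
      (P := d.projector T.card) (Q := 1 - clusterProjection cl T)
      (Z := d.fn fun i => if (i : ℕ) < T.card then (d.val i)⁻¹ else 0)
      (C := clusterMatrix cl fun C => if C ∈ T then 0 else w C) (α := α - ρ) (β := β) (ρ := ρ)
      ?_ ?_ ?_ ?_ ?_ ?_ (by linarith) hρ
    · linarith
    · nth_rewrite 2 [d.eq_fn_val]
      rw [d.projector_eq_fn, d.fn_mul_fn]
      congr 1
      ext i
      simp only [Pi.mul_apply]
      split_ifs with hi
      · have := hlow i hi
        rw [mul_inv_cancel₀ (by linarith)]
      · simp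
    · rw [d.projector_eq_fn, d.fn_mul_fn]
      congr 1
      ext i
      simp only [Pi.mul_apply]
      split_ifs <;> simp
    · rw [sub_mul, mul_sub, one_mul, mul_one, clusterProjection, clusterMatrix_mul,
        clusterMatrix_mul, clusterMatrix_sub, clusterMatrix_sub]
      congr 1
      ext C
      simp only [Pi.sub_apply, Pi.mul_apply]
      split_ifs <;> ring
    · exact IsStarProjection.norm_le _ (isStarProjection_clusterProjection cl T).one_sub
    · refine norm_clusterMatrix_le cl hβ0 fun C => ?_
      split_ifs with h
      · simpa using hβ0
      · exact hβ' C h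
    · have h1 : ‖d.fn fun i => if (i : ℕ) < T.card then (d.val i)⁻¹ else 0‖ ≤ (α - ρ)⁻¹ := by
        refine d.norm_fn_le (by rw [inv_nonneg]; linarith) fun i => ?_
        split_ifs with hi
        · have := hlow i hi
          rw [abs_of_nonneg (by rw [inv_nonneg]; linarith)]
          exact inv_anti₀ (by linarith) this
        · rw [abs_zero, inv_nonneg]; linarith
      calc _ ≤ (α - ρ)⁻¹ * (α - ρ) := by
            apply mul_le_mul_of_nonneg_right h1; linarith
        _ ≤ 1 := inv_mul_le_one
  · have h := norm_mul_le_of_spectral_gap (A := clusterMatrix cl w) (B := A)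
      (P := clusterProjection cl T) (Q := 1 - d.projector T.card)
      (Z := clusterMatrix cl fun C => if C ∈ T then (w C)⁻¹ else 0)
      (C := d.fn fun i => if (i : ℕ) < T.card then 0 else d.val i) (α := α) (β := β + ρ) (ρ := ρ)
      ?_ ?_ ?_ ?_ ?_ ?_ hα0 (by rw [norm_sub_rev]; exact hρ)
    · linarith
    · rw [clusterProjection, clusterMatrix_mul]
      congr 1
      ext C
      simp only [Pi.mul_apply]
      split_ifs with hC
      · have := hα C hC
        rw [mul_inv_cancel₀ (by linarith)]
      · simp
    · rw [clusterProjection, clusterMatrix_mul]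
      congr 1
      ext C
      simp only [Pi.mul_apply]
      split_ifs <;> simp
    · nth_rewrite 2 [d.eq_fn_val]
      rw [sub_mul, mul_sub, one_mul, mul_one, d.projector_eq_fn, d.fn_mul_fn, d.fn_mul_fn,
        ← d.fn_sub, ← d.fn_sub]
      congr 1
      ext i
      simp only [Pi.sub_apply, Pi.mul_apply]
      split_ifs <;> ring
    · exact IsStarProjection.norm_le _ (d.isStarProjection_projector _).one_sub
    · refine d.norm_fn_le (by positivity) fun i => ?_
      split_ifs with hi
      · rw [abs_zero]; positivity
      · rw [abs_le]
        exact ⟨by linarith [hneg i], hup i (not_lt.1 hi)⟩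
    · have h1 : ‖clusterMatrix cl fun C => if C ∈ T then (w C)⁻¹ else 0‖ ≤ α⁻¹ := by
        refine norm_clusterMatrix_le cl (by positivity) fun C => ?_
        split_ifs with hC
        · rw [abs_of_nonneg (inv_nonneg.2 (hw C))]
          exact inv_anti₀ hα0 (hα C hC)
        · rw [abs_zero]; positivity
      calc _ ≤ α⁻¹ * α := by gcongr
        _ ≤ 1 := inv_mul_le_one

/-- Upper bound for the largest eigenvalue, which makes `ŝ` at most slightly larger than the largest
cluster. -/
lemma OrderedEigenbasis.top_le [Nonempty V] {w : ι → ℝ} {c ρ : ℝ} (hc : 0 ≤ c)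
    (hρ : ‖A - clusterMatrix cl w‖ ≤ ρ) (hw : ∀ C, |w C| ≤ c) : d.top ≤ c + ρ := by
  have : Nonempty (Fin (Fintype.card V)) := ⟨⟨0, Fintype.card_pos⟩⟩
  refine ciSup_le fun i => ?_
  have h1 := abs_le.1 (quadForm_sub_le hρ (d.vec i).ofLp)
  have h2 := (le_abs_self _).trans (abs_quadForm_le (clusterMatrix cl w) (d.vec i).ofLp)
  rw [← d.val_eq_quadForm, d.vec_dotProduct] at h1
  rw [d.vec_dotProduct] at h2
  simp only [if_true, mul_one] at h1 h2
  linarith [h1.2, norm_clusterMatrix_le cl hc hw]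

/-- Lower bound for the largest eigenvalue, which makes `ŝ` at least the size of every cluster. -/
lemma OrderedEigenbasis.le_top {w : ι → ℝ} {ρ : ℝ}
    (hρ : ‖A - clusterMatrix cl w‖ ≤ ρ) {C : ι} (hC : (cluster cl C).Nonempty) :
    w C - ρ ≤ d.top := by
  set x : V → ℝ := fun v => (fun D => if D = C then (1 : ℝ) else 0) (cl v) with hx
  obtain ⟨v, hv⟩ := hC
  have hx0 : x ≠ 0 := by
    intro h
    have := congrFun h v
    simp [hx, mem_cluster.1 hv] at this
  have hpos := dotProduct_self_pos hx0
  have h1 : x ⬝ᵥ A *ᵥ x ≤ d.top * (x ⬝ᵥ x) := by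
    rw [d.quadForm_eq, d.dotProduct_self_eq, Finset.mul_sum]
    refine Finset.sum_le_sum fun j _ => ?_
    have : d.val j ≤ d.top := le_ciSup (Set.finite_range d.val).bddAbove j
    gcongr
  have h2 : x ⬝ᵥ clusterMatrix cl w *ᵥ x = w C * (x ⬝ᵥ x) := by
    rw [hx, clusterMatrix_mulVec_comp cl w fun D => if D = C then (1 : ℝ) else 0]
    simp only [dotProduct]
    rw [Finset.mul_sum]
    refine Finset.sum_congr rfl fun u _ => ?_
    split_ifs with h
    · rw [h]; ring
    · simp
  have h3 := abs_le.1 (quadForm_sub_le hρ x)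
  have h4 : (w C - ρ) * (x ⬝ᵥ x) ≤ d.top * (x ⬝ᵥ x) := by linarith [h3.1]
  exact le_of_mul_le_mul_right h4 hpos

/-- Every symmetric real matrix has an ordered orthonormal eigenbasis. -/
lemma OrderedEigenbasis.exists_of_isHermitian {A : Matrix V V ℝ} (hA : A.IsHermitian) :
    Nonempty (OrderedEigenbasis A) := by
  let e : Fin (Fintype.card V) ≃ V := Fintype.equivOfCardEq (Fintype.card_fin _)
  refine ⟨⟨hA.eigenvalues₀, hA.eigenvectorBasis.reindex e.symm, hA.eigenvalues₀_antitone, ?_⟩⟩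
  intro i
  rw [OrthonormalBasis.reindex_apply, Equiv.symm_symm, hA.mulVec_eigenvectorBasis]
  congr 1
  simp [Matrix.IsHermitian.eigenvalues, e]

end Weyl

/-! ### One iteration on a typical graph -/

section OneIteration

variable {V ι : Type*} [Fintype V] [DecidableEq V] [DecidableEq ι] {cl : V → ι}

/-- The indicator vector of `W`. -/
def indicatorVec (W : Finset V) : V → ℝ := fun u => if u ∈ W then 1 else 0

lemma norm_indicatorVec (W : Finset V) : ‖WithLp.toLp 2 (indicatorVec W)‖ = √(W.card : ℝ) := by
  rw [← Real.sqrt_sq (norm_nonneg _), norm_toLp_sq]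
  simp [indicatorVec]

lemma norm_indicatorVec_sub (W C : Finset V) :
    ‖WithLp.toLp 2 (indicatorVec W - indicatorVec C)‖ = √((symmDiff W C).card : ℝ) := by
  rw [← Real.sqrt_sq (norm_nonneg _), norm_toLp_sq]
  congr 1
  have : ∀ v, ((indicatorVec W - indicatorVec C) v) ^ 2 =
      if v ∈ symmDiff W C then (1 : ℝ) else 0 := by
    intro v
    simp only [indicatorVec, Pi.sub_apply, Finset.mem_symmDiff]
    by_cases h1 : v ∈ W <;> by_cases h2 : v ∈ C <;> simp [h1, h2]
  simp only [this, Finset.sum_boole]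
  simp

/-- The indicator vector of a cluster with label in `T` lies in the range of the projection. -/
lemma clusterProjection_mulVec_indicatorVec {T : Finset ι} {C : ι} (hC : C ∈ T) :
    clusterProjection cl T *ᵥ indicatorVec (cluster cl C) = indicatorVec (cluster cl C) := by
  have h : indicatorVec (cluster cl C) =
      fun v => (fun D => if D = C then (1 : ℝ) else 0) (cl v) := by
    ext v
    simp [indicatorVec]
  rw [h, clusterProjection, clusterMatrix_mulVec_comp cl _ fun D => if D = C then (1 : ℝ) else 0]
  ext v
  by_cases hv : cl v = C
  · simp [hv, hC]
  · simp [hv]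

lemma sum_cluster_eq (T : Finset ι) (F : V → ℝ) :
    ∑ C ∈ T, ∑ v ∈ cluster cl C, F v = ∑ v, if cl v ∈ T then F v else 0 := by
  have h : ∀ v, (if cl v ∈ T then F v else 0) = ∑ C ∈ T, if cl v = C then F v else 0 := by
    intro v
    rw [Finset.sum_ite_eq]
  simp only [h]
  rw [Finset.sum_comm]
  refine Finset.sum_congr rfl fun C _ => ?_
  rw [← Finset.sum_filter]
  rfl

/-- The projection replaces the indicator vector of `W` by its averages over the clusters in `T`. -/
lemma norm_sq_clusterProjection_mulVec (T : Finset ι) (W : Finset V) :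
    ‖WithLp.toLp 2 (clusterProjection cl T *ᵥ indicatorVec W)‖ ^ 2 =
      ∑ C ∈ T, ((W ∩ cluster cl C).card : ℝ) ^ 2 / (cluster cl C).card := by
  rw [norm_toLp_sq]
  have h : ∀ v, ((clusterProjection cl T *ᵥ indicatorVec W) v) ^ 2 =
      if cl v ∈ T then (((W ∩ cluster cl (cl v)).card : ℝ) / (cluster cl (cl v)).card) ^ 2
      else 0 := by
    intro v
    rw [clusterProjection, clusterMatrix_mulVec]
    have : ∑ u ∈ cluster cl (cl v), indicatorVec W u = ((W ∩ cluster cl (cl v)).card : ℝ) := by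
      simp only [indicatorVec]
      rw [Finset.sum_boole, Finset.filter_mem_eq_inter, Finset.inter_comm]
    rw [this]
    split_ifs
    · ring
    · simp
  simp only [h]
  rw [← sum_cluster_eq T
    fun v => (((W ∩ cluster cl (cl v)).card : ℝ) / (cluster cl (cl v)).card) ^ 2]
  refine Finset.sum_congr rfl fun C _ => ?_
  have h2 : ∀ v ∈ cluster cl C,
      (((W ∩ cluster cl (cl v)).card : ℝ) / (cluster cl (cl v)).card) ^ 2 =
      (((W ∩ cluster cl C).card : ℝ) / (cluster cl C).card) ^ 2 := by
    intro v hv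
    rw [mem_cluster.1 hv]
  rw [Finset.sum_congr rfl h2, Finset.sum_const, nsmul_eq_mul]
  by_cases h0 : ((cluster cl C).card : ℝ) = 0
  · simp [h0]
  · field_simp

/-- A column in which the two projections are close, relative to the size of its cluster, exists
by averaging. -/
lemma exists_column_close {T : Finset ι} {R : Matrix V V ℝ} {δ : ℝ} (hT : T.Nonempty)
    (hne : ∀ C ∈ T, (cluster cl C).Nonempty)
    (h : ∑ v, ∑ u, (R u v - clusterProjection cl T u v) ^ 2 ≤ T.card * δ) :
    ∃ v, cl v ∈ T ∧
      (∑ u, (R u v - clusterProjection cl T u v) ^ 2) * (cluster cl (cl v)).card ≤ δ := by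
  by_contra! hcon
  set F : V → ℝ := fun v => ∑ u, (R u v - clusterProjection cl T u v) ^ 2 with hF
  have hF0 : ∀ v, 0 ≤ F v := fun v => Finset.sum_nonneg fun u _ => sq_nonneg _
  have h1 : ∑ C ∈ T, ∑ v ∈ cluster cl C, F v ≤ ∑ v, F v := by
    rw [sum_cluster_eq]
    refine Finset.sum_le_sum fun v _ => ?_
    split_ifs
    · exact le_rfl
    · exact hF0 v
  have h2 : ∑ C ∈ T, δ < ∑ C ∈ T, ∑ v ∈ cluster cl C, F v := by
    refine Finset.sum_lt_sum_of_nonempty hT fun C hC => ?_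
    have hpos : (0 : ℝ) < (cluster cl C).card := by exact_mod_cast Finset.card_pos.2 (hne C hC)
    have : ∑ v ∈ cluster cl C, δ / (cluster cl C).card < ∑ v ∈ cluster cl C, F v := by
      refine Finset.sum_lt_sum_of_nonempty (hne C hC) fun v hv => ?_
      have hv' := mem_cluster.1 hv
      have := hcon v (by rw [hv']; exact hC)
      rw [hv'] at this
      rwa [div_lt_iff₀ hpos]
    rw [Finset.sum_const, nsmul_eq_mul, mul_div_cancel₀ _ hpos.ne'] at this
    exact this
  rw [Finset.sum_const, nsmul_eq_mul] at h2
  linarith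

/-- Thresholding a column close to the corresponding column of the cluster projection recovers
the cluster approximately. -/
lemma card_symmDiff_le {T : Finset ι} {R : Matrix V V ℝ} {s : ℝ} {v : V} (hs : 0 < s)
    (hv : cl v ∈ T) (hC : ((cluster cl (cl v)).card : ℝ) ≤ s) {W : Finset V}
    (hW : ∀ u, u ∈ W ↔ 1 / (2 * s) ≤ R u v) :
    ((symmDiff W (cluster cl (cl v))).card : ℝ) ≤
      4 * s ^ 2 * ∑ u, (R u v - clusterProjection cl T u v) ^ 2 := by
  have h1 : ∀ u ∈ symmDiff W (cluster cl (cl v)),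
      (1 / (2 * s)) ^ 2 ≤ (R u v - clusterProjection cl T u v) ^ 2 := by
    intro u hu
    have hs2 : 0 < 1 / (2 * s) := by positivity
    rcases Finset.mem_symmDiff.1 hu with ⟨h1, h2⟩ | ⟨h1, h2⟩
    · have hne : cl u ≠ cl v := fun h => h2 (mem_cluster.2 h)
      have : clusterProjection cl T u v = 0 := by simp [clusterProjection, clusterMatrix_apply, hne]
      rw [this, sub_zero]
      exact pow_le_pow_left₀ hs2.le ((hW u).1 h1) 2
    · have he := mem_cluster.1 h1
      have hP : clusterProjection cl T u v = 1 / (cluster cl (cl v)).card := by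
        simp [clusterProjection, clusterMatrix_apply, he, hv]
      have hR : R u v < 1 / (2 * s) := not_le.1 fun h => h2 ((hW u).2 h)
      have hle : 1 / s ≤ 1 / ((cluster cl (cl v)).card : ℝ) :=
        one_div_le_one_div_of_le (card_cluster_pos cl v) hC
      have hhalf : 1 / s = 1 / (2 * s) + 1 / (2 * s) := by field_simp; norm_num
      rw [← neg_sub, neg_sq, hP]
      exact pow_le_pow_left₀ hs2.le (by linarith) 2
  have h2 : ((symmDiff W (cluster cl (cl v))).card : ℝ) * (1 / (2 * s)) ^ 2 ≤
      ∑ u, (R u v - clusterProjection cl T u v) ^ 2 := by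
    calc _ = ∑ u ∈ symmDiff W (cluster cl (cl v)), (1 / (2 * s)) ^ 2 := by simp
      _ ≤ ∑ u ∈ symmDiff W (cluster cl (cl v)), (R u v - clusterProjection cl T u v) ^ 2 :=
        Finset.sum_le_sum h1
      _ ≤ _ := Finset.sum_le_sum_of_subset_of_nonneg (Finset.subset_univ _)
        fun _ _ _ => sq_nonneg _
  calc ((symmDiff W (cluster cl (cl v))).card : ℝ)
      = 4 * s ^ 2 * (((symmDiff W (cluster cl (cl v))).card : ℝ) * (1 / (2 * s)) ^ 2) := by
        field_simp; norm_num
    _ ≤ _ := by gcongr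

/-- The projected indicator vector of a set close to a cluster is long. -/
lemma le_norm_mulVec_of_close {T : Finset ι} {R : Matrix V V ℝ} {ε σ s : ℝ} (hR : ‖R‖ ≤ 1)
    (hRP : ‖R - clusterProjection cl T‖ ≤ ε / 500) (hε : 0 < ε) (hε1 : ε ≤ 1 / 100) (hσ : 0 < σ)
    (hsσ : s ≤ (1 + 1.01 * ε) * σ)
    {C : ι} (hC : C ∈ T) (hσC : σ ≤ (cluster cl C).card) {W : Finset V}
    (hW : ((symmDiff W (cluster cl C)).card : ℝ) ≤ ε ^ 2 * s / 100000) :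
    √σ * (1 - ε / 100) ≤ ‖WithLp.toLp 2 (R *ᵥ indicatorVec W)‖ := by
  set P := clusterProjection cl T
  set x := indicatorVec (cluster cl C) with hx
  have e : WithLp.toLp 2 (R *ᵥ indicatorVec W) = WithLp.toLp 2 x +
      (WithLp.toLp 2 ((R - P) *ᵥ x) + WithLp.toLp 2 (R *ᵥ (indicatorVec W - x))) := by
    rw [← WithLp.toLp_add, ← WithLp.toLp_add]
    congr 1
    rw [Matrix.sub_mulVec, Matrix.mulVec_sub, hx, clusterProjection_mulVec_indicatorVec hC]
    ext v
    simp only [Pi.add_apply, Pi.sub_apply]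
    ring
  have h1 := norm_toLp_mulVec_le (R - P) x
  have h2 := norm_toLp_mulVec_le R (indicatorVec W - x)
  rw [norm_indicatorVec_sub] at h2
  have h3 : ‖WithLp.toLp 2 x‖ = √((cluster cl C).card : ℝ) := norm_indicatorVec _
  rw [h3] at h1
  have h4 : √σ ≤ √((cluster cl C).card : ℝ) := Real.sqrt_le_sqrt hσC
  have h5 : √((symmDiff W (cluster cl C)).card : ℝ) ≤ ε / 250 * √σ := by
    rw [show ε / 250 = √((ε / 250) ^ 2) from (Real.sqrt_sq (by positivity)).symm,
      ← Real.sqrt_mul (by positivity)]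
    refine Real.sqrt_le_sqrt (hW.trans ?_)
    have : s ≤ 1.02 * σ := by nlinarith
    have : ε ^ 2 * s ≤ ε ^ 2 * (1.02 * σ) := by gcongr
    have : 0 < ε ^ 2 * σ := by positivity
    linarith
  have hs0 := Real.sqrt_nonneg ((cluster cl C).card : ℝ)
  have h6 : ‖WithLp.toLp 2 ((R - P) *ᵥ x)‖ ≤ ε / 500 * √((cluster cl C).card : ℝ) :=
    h1.trans (by gcongr)
  have h7 : ‖WithLp.toLp 2 (R *ᵥ (indicatorVec W - x))‖ ≤ ε / 250 * √σ := by
    refine h2.trans ((mul_le_of_le_one_left (Real.sqrt_nonneg _) hR).trans h5)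
  rw [e]
  have h8 := norm_sub_norm_le (WithLp.toLp 2 x)
    (-(WithLp.toLp 2 ((R - P) *ᵥ x) + WithLp.toLp 2 (R *ᵥ (indicatorVec W - x))))
  rw [norm_neg, sub_neg_eq_add, h3] at h8
  have h9 := norm_add_le (WithLp.toLp 2 ((R - P) *ᵥ x))
    (WithLp.toLp 2 (R *ᵥ (indicatorVec W - x)))
  have h10 : √σ * (1 - ε / 500) ≤ √((cluster cl C).card : ℝ) * (1 - ε / 500) := by
    gcongr; linarith
  have : 0 < ε * √σ := mul_pos hε (Real.sqrt_pos.2 hσ)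
  linarith

/-- A small set whose projected indicator vector is long captures almost all of some cluster. -/
lemma exists_cluster_inter_large {T : Finset ι} {R : Matrix V V ℝ} {ε σ s : ℝ}
    (hRP : ‖R - clusterProjection cl T‖ ≤ ε / 500) (hε : 0 < ε) (hε1 : ε ≤ 1 / 100) (hσ : 0 < σ)
    (hsσ : s ≤ (1 + 1.01 * ε) * σ) (hσT : ∀ C ∈ T, σ ≤ (cluster cl C).card) {W : Finset V}
    (hW : (W.card : ℝ) ≤ (1 + ε) * s)
    (hlong : √σ * (1 - ε / 100) ≤ ‖WithLp.toLp 2 (R *ᵥ indicatorVec W)‖) :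
    ∃ C ∈ T, (1 - 3 * ε) * (cluster cl C).card ≤ ((W ∩ cluster cl C).card : ℝ) := by
  have hW2 : (W.card : ℝ) ≤ (1 + 2.1 * ε) * σ := by
    refine hW.trans ?_
    have : (1 + ε) * s ≤ (1 + ε) * ((1 + 1.01 * ε) * σ) := by gcongr
    nlinarith [mul_pos hε hσ]
  have hsq : √(W.card : ℝ) ≤ 2 * √σ := by
    rw [show (2 : ℝ) = √4 by rw [show (4 : ℝ) = 2 ^ 2 by norm_num]; simp,
      ← Real.sqrt_mul (by norm_num)]
    refine Real.sqrt_le_sqrt (hW2.trans ?_)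
    nlinarith
  have h1 := norm_toLp_mulVec_le (R - clusterProjection cl T) (indicatorVec W)
  rw [norm_indicatorVec, Matrix.sub_mulVec, WithLp.toLp_sub] at h1
  have h2 := (norm_sub_norm_le _ _).trans h1
  have h3 : ‖R - clusterProjection cl T‖ * √(W.card : ℝ) ≤ ε / 500 * (2 * √σ) := by gcongr
  have h4 : √σ * (1 - ε / 50) ≤
      ‖WithLp.toLp 2 (clusterProjection cl T *ᵥ indicatorVec W)‖ := by
    have : 0 < ε * √σ := mul_pos hε (Real.sqrt_pos.2 hσ)
    linarith
  have h5 : σ * (1 - ε / 25) ≤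
      ∑ C ∈ T, ((W ∩ cluster cl C).card : ℝ) ^ 2 / (cluster cl C).card := by
    rw [← norm_sq_clusterProjection_mulVec]
    refine le_trans ?_ (pow_le_pow_left₀ (mul_nonneg (Real.sqrt_nonneg _) (by linarith)) h4 2)
    rw [mul_pow, Real.sq_sqrt hσ.le]
    gcongr
    nlinarith
  -- Otherwise `‖P 1_W‖² = ∑ |W ∩ C|² / |C|` is at most `(1 - 3ε) |W|`, which is too small.
  by_contra! hcon
  have h6 : ∑ C ∈ T, ((W ∩ cluster cl C).card : ℝ) ^ 2 / (cluster cl C).card ≤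
      ∑ C ∈ T, (1 - 3 * ε) * ((W ∩ cluster cl C).card : ℝ) := by
    refine Finset.sum_le_sum fun C hC => ?_
    have hpos : (0 : ℝ) < (cluster cl C).card := hσ.trans_le (hσT C hC)
    rw [div_le_iff₀ hpos]
    have := (hcon C hC).le
    have h0 : (0 : ℝ) ≤ (W ∩ cluster cl C).card := Nat.cast_nonneg _
    nlinarith
  have h7 : ∑ C ∈ T, ((W ∩ cluster cl C).card : ℝ) ≤ W.card := by
    have : ∀ C, ((W ∩ cluster cl C).card : ℝ) = ∑ v ∈ cluster cl C, indicatorVec W v := by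
      intro C
      simp only [indicatorVec]
      rw [Finset.sum_boole, Finset.filter_mem_eq_inter, Finset.inter_comm]
    simp only [this]
    rw [sum_cluster_eq]
    calc _ ≤ ∑ v, indicatorVec W v := by
          refine Finset.sum_le_sum fun v _ => ?_
          simp only [indicatorVec]
          split_ifs <;> norm_num
      _ = W.card := by simp [indicatorVec]
  rw [← Finset.mul_sum] at h6
  have h8 : (1 - 3 * ε) * ∑ C ∈ T, ((W ∩ cluster cl C).card : ℝ) ≤
      (1 - 3 * ε) * ((1 + 2.1 * ε) * σ) := by
    gcongr
    · linarith
    · exact h7.trans hW2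
  nlinarith [mul_pos hε hσ]

variable {H : SimpleGraph V} {p q ε σ g : ℝ}

/-- The hypotheses under which an iteration of the algorithm is analysed: `σ` bounds from below the
sizes of the clusters in the current supercluster `T`, which differ by a factor of at most `1 + ε`,
all other clusters are smaller by `g`, the graph is spectrally close to its expectation, and the
numbers of neighbours in the clusters in `T` are close to their expectations. -/
structure IsTypical (H : SimpleGraph V) (cl : V → ι) (T : Finset ι) (p q ε σ g : ℝ) : Prop where
  nonneg : 0 ≤ q
  le_one : p ≤ 1
  eps_pos : 0 < ε
  eps_le : 100 * ε ≤ p - q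
  nonempty : T.Nonempty
  size_pos : 0 < σ
  size_ge : ∀ C ∈ T, σ ≤ (cluster cl C).card
  size_le : ∀ C ∈ T, ((cluster cl C).card : ℝ) ≤ (1 + ε) * σ
  size_other : ∀ C, C ∉ T → ((cluster cl C).card : ℝ) ≤ σ - g
  gap_le : g ≤ σ
  gap_ge : 10000 * √(Fintype.card V : ℝ) ≤ (p - q) * ε * g
  spectral : ‖bHat H p q - clusterMatrix cl fun C => (p - q) * (cluster cl C).card‖ ≤
    7 * √(Fintype.card V : ℝ)
  degree_in : ∀ u, cl u ∈ T → (p - ε) * (cluster cl (cl u)).card ≤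
    (Set.ncard {w | w ∈ cluster cl (cl u) ∧ H.Adj u w} : ℝ)
  degree_out : ∀ u, ∀ C ∈ T, cl u ≠ C →
    (Set.ncard {w | w ∈ cluster cl C ∧ H.Adj u w} : ℝ) ≤ (q + ε) * (cluster cl C).card

namespace IsTypical

variable {T : Finset ι} (h : IsTypical H cl T p q ε σ g) (d : OrderedEigenbasis (bHat H p q))

include h

lemma cluster_nonempty {C : ι} (hC : C ∈ T) : (cluster cl C).Nonempty := by
  have := h.size_pos.trans_le (h.size_ge C hC)
  exact Finset.card_pos.1 (by exact_mod_cast this)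

lemma nonempty_vertices : Nonempty V := by
  obtain ⟨C, hC⟩ := h.nonempty
  obtain ⟨v, _⟩ := h.cluster_nonempty hC
  exact ⟨v⟩

lemma sqrt_card_pos : 0 < √(Fintype.card V : ℝ) := by
  have := h.nonempty_vertices
  exact Real.sqrt_pos.2 (by exact_mod_cast Fintype.card_pos)

/-- The spectral gap `(p - q) g` exceeds the noise `7 √|V|` by a factor of order `1 / ε`, so the
empirical and the ideal projection differ by a small multiple of `ε`. -/
lemma projector_close :
    ‖(1 - clusterProjection cl T) * d.projector T.card‖ ≤ ε / 1000 ∧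
    ‖(1 - d.projector T.card) * clusterProjection cl T‖ ≤ ε / 1000 := by
  have hm := h.sqrt_card_pos
  have hε := h.eps_pos
  have hΔ : 0 < p - q := by linarith [h.eps_le]
  have hg := h.gap_ge
  have hε1 : ε ≤ 1 / 100 := by linarith [h.eps_le, h.nonneg, h.le_one]
  have hg2 : 9993 * √(Fintype.card V : ℝ) ≤
      ε * ((p - q) * σ - (p - q) * (σ - g) - 7 * √(Fintype.card V : ℝ)) := by
    have : ε * (7 * √(Fintype.card V : ℝ)) ≤ 1 * (7 * √(Fintype.card V : ℝ)) := by
      gcongr; linarith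
    linarith
  have hgap : 0 < (p - q) * σ - (p - q) * (σ - g) - 7 * √(Fintype.card V : ℝ) := by
    -- A nonpositive right-hand side in `hg2` would force the vertex set to be empty.
    by_contra! hneg
    nlinarith
  have hβ : 0 ≤ (p - q) * (σ - g) := mul_nonneg hΔ.le (by linarith [h.gap_le])
  have key := d.projector_perturbation (T := T) (α := (p - q) * σ) (β := (p - q) * (σ - g))
    hβ h.spectral
    (fun C hC => h.cluster_nonempty hC)
    (fun C hC => by have := h.size_ge C hC; gcongr)
    (fun C => by positivity)
    (fun C hC => by have := h.size_other C hC; gcongr)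
    (by linarith)
  have aux : ∀ x : ℝ, 0 ≤ x →
      x * ((p - q) * σ - (p - q) * (σ - g) - 7 * √(Fintype.card V : ℝ)) ≤
        7 * √(Fintype.card V : ℝ) → x ≤ ε / 1000 := by
    intro x hx hxle
    have h1 : x * (9993 * √(Fintype.card V : ℝ)) ≤ ε * (7 * √(Fintype.card V : ℝ)) := by
      calc _ ≤ x * (ε * ((p - q) * σ - (p - q) * (σ - g) - 7 * √(Fintype.card V : ℝ))) := by
            gcongr
        _ = ε * (x * ((p - q) * σ - (p - q) * (σ - g) - 7 * √(Fintype.card V : ℝ))) := by ring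
        _ ≤ _ := by gcongr
    have h2 : (x * 9993) * √(Fintype.card V : ℝ) ≤ (ε * 7) * √(Fintype.card V : ℝ) := by linarith
    have h3 := le_of_mul_le_mul_right h2 hm
    linarith
  exact ⟨aux _ (norm_nonneg _) key.1, aux _ (norm_nonneg _) key.2⟩

lemma eps_le_hundredth : ε ≤ 1 / 100 := by linarith [h.eps_le, h.nonneg, h.le_one]

lemma card_le_sHat {C : ι} (hC : C ∈ T) : ((cluster cl C).card : ℝ) ≤ sHat d := by
  have hΔ : 0 < p - q := by linarith [h.eps_le, h.eps_pos]
  have := d.le_top h.spectral (h.cluster_nonempty hC)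
  rw [sHat, le_div_iff₀ hΔ]
  linarith

lemma sHat_le : sHat d ≤ (1 + 1.01 * ε) * σ := by
  have := h.nonempty_vertices
  have hε := h.eps_pos
  have hΔ : 0 < p - q := by linarith [h.eps_le, h.eps_pos]
  have hσ := h.size_pos
  have hm := h.sqrt_card_pos
  have hg0 : 0 ≤ g := by
    by_contra! hneg
    nlinarith [h.gap_ge, mul_pos hΔ hε]
  have h1 := d.top_le (c := (p - q) * ((1 + ε) * σ)) (by positivity) h.spectral (by
    intro C
    rw [abs_of_nonneg (by positivity)]
    gcongr
    by_cases hC : C ∈ T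
    · exact h.size_le C hC
    · have := h.size_other C hC
      nlinarith)
  rw [sHat, div_le_iff₀ hΔ]
  have h2 : (p - q) * ε * g ≤ (p - q) * ε * σ := by have := h.gap_le; gcongr
  linarith [h.gap_ge]

lemma size_le_sHat : σ ≤ sHat d := by
  obtain ⟨C, hC⟩ := h.nonempty
  exact (h.size_ge C hC).trans (h.card_le_sHat d hC)

lemma norm_projector_sub_le :
    ‖d.projector T.card - clusterProjection cl T‖ ≤ ε / 500 := by
  have := norm_projection_sub_le (isStarProjection_clusterProjection cl T)
    (d.isStarProjection_projector T.card) (h.projector_close d).1 (h.projector_close d).2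
  linarith

/-- Some column of the projector determines its cluster up to few vertices. The rank of both
projections is the number of clusters in `T`, so that on average over these clusters the squared
Frobenius distance is of order `ε ^ 2` per cluster. -/
lemma exists_good_column : ∃ v, cl v ∈ T ∧
    ((symmDiff (largeEntries d T.card v) (cluster cl (cl v))).card : ℝ) ≤
      ε ^ 2 * sHat d / 100000 := by
  have hε := h.eps_pos
  have hε1 := h.eps_le_hundredth
  have hσ := h.size_pos
  have hs : 0 < sHat d := hσ.trans_le (h.size_le_sHat d)
  have h1 := sum_sq_projection_sub_le (isStarProjection_clusterProjection cl T)
    (d.isStarProjection_projector T.card) (h.projector_close d).1 (h.projector_close d).2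
    (trace_clusterProjection_le cl T) (d.trace_projector_le _) (Nat.cast_nonneg _)
  obtain ⟨v, hv, hle⟩ := exists_column_close (δ := 2 * (ε / 1000) ^ 2) h.nonempty
    (fun C hC => h.cluster_nonempty hC) (h1.trans_eq (by ring))
  refine ⟨v, hv, ?_⟩
  have h2 := card_symmDiff_le (T := T) (R := d.projector T.card) hs hv (h.card_le_sHat d hv)
    (W := largeEntries d T.card v) (by intro u; simp [largeEntries])
  refine h2.trans ?_
  set F := ∑ u, (d.projector T.card u v - clusterProjection cl T u v) ^ 2 with hF
  have hF0 : 0 ≤ F := Finset.sum_nonneg fun u _ => sq_nonneg _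
  have h3 : F * σ ≤ 2 * (ε / 1000) ^ 2 :=
    le_trans (by have := h.size_ge _ hv; gcongr) hle
  have h4 : sHat d ≤ 1.02 * σ := (h.sHat_le d).trans (by nlinarith)
  calc 4 * sHat d ^ 2 * F = 4 * sHat d * (sHat d * F) := by ring
    _ ≤ 4 * sHat d * (1.02 * σ * F) := by gcongr
    _ = 4.08 * sHat d * (F * σ) := by ring
    _ ≤ 4.08 * sHat d * (2 * (ε / 1000) ^ 2) := by gcongr
    _ ≤ ε ^ 2 * sHat d / 100000 := by
      have : 0 < ε ^ 2 * sHat d := by positivity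
      linarith

/-- A good column is admissible, and gives a lower bound for the quantity maximized by the pivot. -/
lemma exists_admissible_long : ∃ v, Admissible d ε T.card v ∧
    √σ * (1 - ε / 100) ≤ projNorm d T.card (largeEntries d T.card v) := by
  have hε := h.eps_pos
  have hε1 := h.eps_le_hundredth
  have hs : 0 < sHat d := h.size_pos.trans_le (h.size_le_sHat d)
  obtain ⟨v, hv, hle⟩ := h.exists_good_column d
  refine ⟨v, ?_, ?_⟩
  · have h1 : (largeEntries d T.card v).card ≤ (cluster cl (cl v)).card +
        (symmDiff (largeEntries d T.card v) (cluster cl (cl v))).card := by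
      refine le_trans (Finset.card_le_card ?_) (Finset.card_union_le _ _)
      intro u hu
      by_cases hc : u ∈ cluster cl (cl v)
      · exact Finset.mem_union_left _ hc
      · exact Finset.mem_union_right _ (Finset.mem_symmDiff.2 (Or.inl ⟨hu, hc⟩))
    have h2 : ((largeEntries d T.card v).card : ℝ) ≤ (cluster cl (cl v)).card +
        (symmDiff (largeEntries d T.card v) (cluster cl (cl v))).card := by exact_mod_cast h1
    have h3 := h.card_le_sHat d hv
    have h4 : ε ^ 2 * sHat d / 100000 ≤ ε * sHat d := by
      have : ε * (ε * sHat d) ≤ 1 * (ε * sHat d) := by gcongr; linarith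
      nlinarith [mul_pos hε hs]
    rw [Admissible]
    linarith
  · exact le_norm_mulVec_of_close
      (IsStarProjection.norm_le _ (d.isStarProjection_projector T.card))
      (h.norm_projector_sub_le d) hε hε1 h.size_pos (h.sHat_le d) hv (h.size_ge _ hv) hle

/-- A vertex is extracted exactly if it lies in the cluster that the pivot set approximates. -/
lemma extracted_eq_cluster {v : V} (hv : IsPivot d ε T.card v) :
    ∃ C ∈ T, extracted d ε T.card v = cluster cl C := by
  have hε := h.eps_pos
  have hε1 := h.eps_le_hundredth
  have hσ := h.size_pos
  have hs : 0 < sHat d := hσ.trans_le (h.size_le_sHat d)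
  obtain ⟨v', hadm, hlong⟩ := h.exists_admissible_long d
  have hlong' := hlong.trans (hv.2 v' hadm)
  obtain ⟨C, hC, hcap⟩ := exists_cluster_inter_large (h.norm_projector_sub_le d) hε hε1 hσ
    (h.sHat_le d) h.size_ge hv.1 hlong'
  set W := largeEntries d T.card v with hW
  refine ⟨C, hC, ?_⟩
  have hWcard : (W.card : ℝ) ≤ (1 + ε) * sHat d := hv.1
  have hsle := h.sHat_le d
  have hσC := h.size_ge C hC
  have hCs := h.card_le_sHat d hC
  -- Outside of the cluster, the pivot set has only few elements.
  have hout : ((W \ cluster cl C).card : ℝ) ≤ 5.1 * ε * sHat d := by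
    have h1 : ((W \ cluster cl C).card : ℝ) + (W ∩ cluster cl C).card = W.card := by
      exact_mod_cast Finset.card_sdiff_add_card_inter W (cluster cl C)
    have h2 : (1 - 3 * ε) * σ ≤ (1 - 3 * ε) * (cluster cl C).card := by gcongr; linarith
    have h3 : (1 + ε) * sHat d ≤ (1 + ε) * ((1 + 1.01 * ε) * σ) := by gcongr
    have h4 := h.size_le_sHat d
    have h5 : 5.1 * ε * σ ≤ 5.1 * ε * sHat d := by gcongr
    nlinarith [mul_pos hε hσ]
  have hin : ((cluster cl C \ W).card : ℝ) ≤ 3 * ε * (cluster cl C).card := by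
    have h1 : ((cluster cl C \ W).card : ℝ) + (cluster cl C ∩ W).card = (cluster cl C).card := by
      exact_mod_cast Finset.card_sdiff_add_card_inter (cluster cl C) W
    rw [Finset.inter_comm] at h1
    linarith
  classical
  have hfil : ∀ u, (Set.ncard {w | w ∈ cluster cl C ∧ H.Adj u w}) =
      ((cluster cl C).filter fun w => H.Adj u w).card := by
    intro u
    rw [← Set.ncard_coe_finset]
    congr 1
    ext w
    simp
  ext u
  have hmem : u ∈ extracted d ε T.card v ↔
      (p - 10 * ε) * sHat d ≤ ((W.filter fun w => H.Adj u w).card : ℝ) := by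
    simp only [extracted, Finset.mem_filter, Finset.mem_univ, true_and]
    rw [hW]
  rw [hmem, mem_cluster]
  constructor
  · intro hu
    by_contra hne
    have h1 : (W.filter fun w => H.Adj u w).card ≤
        ((cluster cl C).filter fun w => H.Adj u w).card + (W \ cluster cl C).card := by
      refine le_trans (Finset.card_le_card ?_) (Finset.card_union_le _ _)
      intro w hw
      have hw' := Finset.mem_filter.1 hw
      by_cases hc : w ∈ cluster cl C
      · exact Finset.mem_union_left _ (Finset.mem_filter.2 ⟨hc, hw'.2⟩)
      · exact Finset.mem_union_right _ (Finset.mem_sdiff.2 ⟨hw'.1, hc⟩)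
    have h2 : ((W.filter fun w => H.Adj u w).card : ℝ) ≤
        ((cluster cl C).filter fun w => H.Adj u w).card + (W \ cluster cl C).card := by
      exact_mod_cast h1
    have h3 := h.degree_out u C hC hne
    rw [hfil] at h3
    have h4 : (q + ε) * (cluster cl C).card ≤ (q + ε) * sHat d := by
      have := h.nonneg
      gcongr
    have h5 : (q + ε + 5.1 * ε) * sHat d < (p - 10 * ε) * sHat d := by
      have := h.eps_le
      gcongr
      linarith
    linarith
  · intro hu
    have h1 : ((cluster cl C).filter fun w => H.Adj u w).card ≤
        (W.filter fun w => H.Adj u w).card + (cluster cl C \ W).card := by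
      refine le_trans (Finset.card_le_card ?_) (Finset.card_union_le _ _)
      intro w hw
      have hw' := Finset.mem_filter.1 hw
      by_cases hc : w ∈ W
      · exact Finset.mem_union_left _ (Finset.mem_filter.2 ⟨hc, hw'.2⟩)
      · exact Finset.mem_union_right _ (Finset.mem_sdiff.2 ⟨hw'.1, hc⟩)
    have h2 : (((cluster cl C).filter fun w => H.Adj u w).card : ℝ) ≤
        (W.filter fun w => H.Adj u w).card + (cluster cl C \ W).card := by
      exact_mod_cast h1
    have h3 := h.degree_in u (by rw [hu]; exact hC)
    rw [hu, hfil] at h3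
    have hp : 100 * ε ≤ p := by linarith [h.eps_le, h.nonneg]
    have hp1 := h.le_one
    have h4 : (p - 4 * ε) * σ ≤ (p - 4 * ε) * (cluster cl C).card := by
      gcongr
      linarith
    have h5 : (p - 10 * ε) * sHat d ≤ (p - 10 * ε) * ((1 + 1.01 * ε) * σ) := by
      gcongr
      linarith
    have h6 : (p - 10 * ε) * ((1 + 1.01 * ε) * σ) ≤ (p - 4 * ε) * σ := by
      have : (p - 10 * ε) * (1 + 1.01 * ε) ≤ p - 4 * ε := by nlinarith
      calc _ = ((p - 10 * ε) * (1 + 1.01 * ε)) * σ := by ring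
        _ ≤ _ := by gcongr
    linarith

end IsTypical

end OneIteration

/-! ### The whole algorithm on a good graph -/

section Correctness

variable {n : ℕ} (P : Finpartition (Finset.univ : Finset (Fin n)))

/-- The union of the clusters in `𝒟`. -/
def unionOf (𝒟 : Finset (Finset (Fin n))) : Finset (Fin n) :=
  Finset.univ.filter fun v => P.part v ∈ 𝒟

/-- The map that sends a vertex of the induced subgraph on `U` to its cluster. -/
def label (U : Finset (Fin n)) (v : (U : Set (Fin n))) : Finset (Fin n) := P.part v

/-- The clusters that occur in a list of superclusters. -/
def members (L : List (Finset (Finset (Fin n)))) : Finset (Finset (Fin n)) :=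
  P.parts.filter fun C => ∃ T ∈ L, C ∈ T

variable {P}

lemma part_eq_iff {C : Finset (Fin n)} (hC : C ∈ P.parts) {v : Fin n} : P.part v = C ↔ v ∈ C :=
  ⟨fun h => h ▸ P.mem_part (Finset.mem_univ v), fun h => P.part_eq_of_mem hC h⟩

lemma map_cluster_label {𝒟 : Finset (Finset (Fin n))} {C : Finset (Fin n)} (hC : C ∈ P.parts)
    (hD : C ∈ 𝒟) : (cluster (label P (unionOf P 𝒟)) C).map (Function.Embedding.subtype _) = C := by
  ext v
  simp only [Finset.mem_map, mem_cluster, label, Function.Embedding.subtype_apply]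
  constructor
  · rintro ⟨w, hw, rfl⟩
    exact (part_eq_iff hC).1 hw
  · intro hv
    have := (part_eq_iff hC).2 hv
    exact ⟨⟨v, by simp [unionOf, this, hD]⟩, this, rfl⟩

lemma card_cluster_label {𝒟 : Finset (Finset (Fin n))} {C : Finset (Fin n)} (hC : C ∈ P.parts)
    (hD : C ∈ 𝒟) : (cluster (label P (unionOf P 𝒟)) C).card = C.card := by
  conv_rhs => rw [← map_cluster_label hC hD]
  rw [Finset.card_map]

/-- Clusters that have been deleted count as empty. -/
lemma cluster_label_eq_empty {𝒟 : Finset (Finset (Fin n))} {C : Finset (Fin n)}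
    (hD : C ∉ 𝒟) : cluster (label P (unionOf P 𝒟)) C = ∅ := by
  refine Finset.eq_empty_of_forall_notMem fun v hv => hD ?_
  have h := mem_cluster.1 hv
  have h2 := v.2
  simp only [unionOf, Finset.coe_filter, Finset.mem_univ, true_and, Set.mem_ofPred_eq] at h2
  rw [← h]
  exact h2

lemma ncard_neighbours_label {𝒟 : Finset (Finset (Fin n))} {C : Finset (Fin n)}
    (hC : C ∈ P.parts) (hD : C ∈ 𝒟) (G : SimpleGraph (Fin n))
    (u : (unionOf P 𝒟 : Set (Fin n))) :
    Set.ncard {w | w ∈ cluster (label P (unionOf P 𝒟)) C ∧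
      (G.induce (unionOf P 𝒟 : Set (Fin n))).Adj u w} = Set.ncard {w | w ∈ C ∧ G.Adj u w} := by
  rw [← Set.ncard_image_of_injective _ Subtype.val_injective]
  congr 1
  ext w
  simp only [Set.mem_image, Set.mem_ofPred_eq, mem_cluster, label]
  constructor
  · rintro ⟨x, ⟨hx, hadj⟩, rfl⟩
    exact ⟨(part_eq_iff hC).1 hx, hadj⟩
  · rintro ⟨hw, hadj⟩
    have := (part_eq_iff hC).2 hw
    exact ⟨⟨w, by simp [unionOf, this, hD]⟩, ⟨this, hadj⟩, rfl⟩

variable (P) in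
/-- The properties of the random graph that make the algorithm succeed: on every union of clusters
the matrix `B̂` is close to its expectation, and the numbers of neighbours that the vertices have in
the clusters are close to their expectations. -/
structure IsGoodGraph (G : SimpleGraph (Fin n)) (p q ε : ℝ) : Prop where
  spectral : ∀ 𝒟 ⊆ P.parts, 𝒟.Nonempty →
    ‖bHat (G.induce (unionOf P 𝒟 : Set (Fin n))) p q -
      clusterMatrix (label P (unionOf P 𝒟)) fun C =>
        (p - q) * (cluster (label P (unionOf P 𝒟)) C).card‖ ≤
      7 * √(Fintype.card (unionOf P 𝒟 : Set (Fin n)) : ℝ)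
  degree_in : ∀ u, ∀ C ∈ P.parts, u ∈ C →
    (p - ε) * C.card ≤ (Set.ncard {w | w ∈ C ∧ G.Adj u w} : ℝ)
  degree_out : ∀ u, ∀ C ∈ P.parts, u ∉ C →
    (Set.ncard {w | w ∈ C ∧ G.Adj u w} : ℝ) ≤ (q + ε) * C.card

variable (P) in
/-- A list of possibly exhausted superclusters, as the algorithm meets them, with the additive
separation `g`. -/
structure IsRemaining (L : List (Finset (Finset (Fin n)))) (ε g : ℝ) : Prop where
  subset : ∀ T ∈ L, T ⊆ P.parts
  disjoint : L.Pairwise Disjoint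
  separated : L.Pairwise fun T T' => ∀ C ∈ T, ∀ D ∈ T', (D.card : ℝ) + g ≤ C.card
  within : ∀ T ∈ L, ∀ C ∈ T, ∀ D ∈ T, (C.card : ℝ) ≤ (1 + ε) * D.card

lemma IsRemaining.tail {T : Finset (Finset (Fin n))} {L : List (Finset (Finset (Fin n)))} {ε g : ℝ}
    (h : IsRemaining P (T :: L) ε g) : IsRemaining P L ε g where
  subset T' hT' := h.subset T' (List.mem_cons_of_mem _ hT')
  disjoint := (List.pairwise_cons.1 h.disjoint).2
  separated := (List.pairwise_cons.1 h.separated).2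
  within T' hT' := h.within T' (List.mem_cons_of_mem _ hT')

lemma IsRemaining.erase {T : Finset (Finset (Fin n))} {L : List (Finset (Finset (Fin n)))}
    {ε g : ℝ} (h : IsRemaining P (T :: L) ε g) (C : Finset (Fin n)) :
    IsRemaining P (T.erase C :: L) ε g where
  subset T' hT' := by
    rcases List.mem_cons.1 hT' with rfl | hT'
    · exact (Finset.erase_subset _ _).trans (h.subset T (by simp))
    · exact h.subset T' (List.mem_cons_of_mem _ hT')
  disjoint := by
    have := List.pairwise_cons.1 h.disjoint
    exact List.pairwise_cons.2
      ⟨fun T' hT' => (this.1 T' hT').mono_left (Finset.erase_subset _ _), this.2⟩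
  separated := by
    have := List.pairwise_cons.1 h.separated
    exact List.pairwise_cons.2
      ⟨fun T' hT' D hD => this.1 T' hT' D (Finset.mem_of_mem_erase hD), this.2⟩
  within T' hT' := by
    rcases List.mem_cons.1 hT' with rfl | hT'
    · intro D hD E hE
      exact h.within T (by simp) D (Finset.mem_of_mem_erase hD) E (Finset.mem_of_mem_erase hE)
    · exact h.within T' (List.mem_cons_of_mem _ hT')

lemma isTypical_of_isRemaining {G : SimpleGraph (Fin n)} {p q ε g : ℝ} (hq : 0 ≤ q) (hp : p ≤ 1)
    (hε : 0 < ε) (hεp : 100 * ε ≤ p - q) (hg0 : 0 < g) (hg : 10000 * √(n : ℝ) ≤ (p - q) * ε * g)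
    (hlarge : ∀ C ∈ P.parts, g ≤ C.card) (hG : IsGoodGraph P G p q ε)
    {T : Finset (Finset (Fin n))} {L : List (Finset (Finset (Fin n)))}
    (hL : IsRemaining P (T :: L) ε g) (hT : T.Nonempty) :
    ∃ σ, IsTypical (G.induce (unionOf P (members P (T :: L)) : Set (Fin n)))
      (label P (unionOf P (members P (T :: L)))) T p q ε σ g := by
  obtain ⟨D, hD, hmin⟩ := Finset.exists_min_image T Finset.card hT
  have hsub := hL.subset T (by simp)
  have hmem : ∀ C ∈ T, C ∈ members P (T :: L) := fun C hC =>
    Finset.mem_filter.2 ⟨hsub hC, T, by simp, hC⟩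
  have hcard : ∀ C ∈ T, (cluster (label P (unionOf P (members P (T :: L)))) C).card = C.card :=
    fun C hC => card_cluster_label (hsub hC) (hmem C hC)
  have hgD := hlarge D (hsub hD)
  refine ⟨D.card, ?_⟩
  constructor
  · exact hq
  · exact hp
  · exact hε
  · exact hεp
  · exact hT
  · exact hg0.trans_le hgD
  · intro C hC
    rw [hcard C hC]
    exact_mod_cast hmin C hC
  · intro C hC
    rw [hcard C hC]
    exact hL.within T (by simp) C hC D hD
  · intro C hC
    by_cases hC' : C ∈ members P (T :: L)
    · have h2 := Finset.mem_filter.1 hC'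
      rw [card_cluster_label h2.1 hC']
      obtain ⟨T', hT', hCT'⟩ := h2.2
      rcases List.mem_cons.1 hT' with rfl | hT'
      · exact absurd hCT' hC
      · have := (List.pairwise_cons.1 hL.separated).1 T' hT' D hD C hCT'
        linarith
    · rw [cluster_label_eq_empty hC']
      simp only [Finset.card_empty, Nat.cast_zero]
      linarith
  · exact hgD
  · refine le_trans ?_ hg
    gcongr
    have : Fintype.card (unionOf P (members P (T :: L)) : Set (Fin n)) ≤ Fintype.card (Fin n) :=
      Fintype.card_le_of_injective _ Subtype.val_injective
    simpa using this
  · exact hG.spectral _ (Finset.filter_subset _ _) ⟨D, hmem D hD⟩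
  · intro u hu
    rw [hcard _ hu, ncard_neighbours_label (hsub hu) (hmem _ hu)]
    exact hG.degree_in u _ (hsub hu) ((part_eq_iff (hsub hu)).1 rfl)
  · intro u C hC hne
    rw [hcard _ hC, ncard_neighbours_label (hsub hC) (hmem _ hC)]
    exact hG.degree_out u _ (hsub hC) fun h => hne ((part_eq_iff (hsub hC)).2 h)

/-- Deleting the vertices of a cluster amounts to erasing the cluster from its supercluster. -/
lemma unionOf_sdiff {T : Finset (Finset (Fin n))} {L : List (Finset (Finset (Fin n)))} {ε g : ℝ}
    (hL : IsRemaining P (T :: L) ε g) {C : Finset (Fin n)} (hC : C ∈ T) :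
    unionOf P (members P (T :: L)) \ C = unionOf P (members P (T.erase C :: L)) := by
  have hCP := hL.subset T (by simp) hC
  have hdis : ∀ T' ∈ L, C ∉ T' := fun T' hT' h =>
    Finset.disjoint_left.1 ((List.pairwise_cons.1 hL.disjoint).1 T' hT') hC h
  ext v
  simp only [unionOf, members, Finset.mem_sdiff, Finset.mem_filter, Finset.mem_univ, true_and,
    List.mem_cons, exists_eq_or_imp, Finset.mem_erase, ← part_eq_iff hCP]
  constructor
  · rintro ⟨⟨h1, h2⟩, h3⟩
    exact ⟨h1, h2.imp (fun h => ⟨h3, h⟩) id⟩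
  · rintro ⟨h1, h2⟩
    refine ⟨⟨h1, h2.imp (fun h => h.2) id⟩, ?_⟩
    rcases h2 with h2 | ⟨T', hT', h2⟩
    · exact h2.1
    · rintro rfl
      exact hdis T' hT' h2

lemma isHermitian_bHat {V : Type*} [Fintype V] [DecidableEq V] (H : SimpleGraph V) (p q : ℝ) :
    (bHat H p q).IsHermitian := by
  ext u v
  have h := H.adj_comm u v
  by_cases h1 : H.Adj v u <;> simp [bHat, Matrix.one_apply, eq_comm, h, h1]

lemma exists_isPivot {V : Type*} [Fintype V] [DecidableEq V] {H : SimpleGraph V} {p q : ℝ}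
    (d : OrderedEigenbasis (bHat H p q)) {ε : ℝ} {r : ℕ} (h : ∃ v, Admissible d ε r v) :
    ∃ v, IsPivot d ε r v := by
  classical
  obtain ⟨v, hv⟩ := h
  obtain ⟨w, hw, hmax⟩ := Finset.exists_max_image (Finset.univ.filter fun v => Admissible d ε r v)
    (fun v => projNorm d r (largeEntries d r v)) ⟨v, by simpa using hv⟩
  exact ⟨w, (Finset.mem_filter.1 hw).2, fun u hu => hmax u (by simpa using hu)⟩

/-- On a good graph, every run of the algorithm that starts from the clusters in the list `L` of
superclusters extracts exactly these clusters. -/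
theorem run_correct {G : SimpleGraph (Fin n)} {p q ε g : ℝ} (hq : 0 ≤ q) (hp : p ≤ 1)
    (hε : 0 < ε) (hεp : 100 * ε ≤ p - q) (hg0 : 0 < g) (hg : 10000 * √(n : ℝ) ≤ (p - q) * ε * g)
    (hlarge : ∀ C ∈ P.parts, g ≤ C.card) (hG : IsGoodGraph P G p q ε)
    (L : List (Finset (Finset (Fin n)))) (hL : IsRemaining P L ε g) :
    (∃ out, Run G p q ε (unionOf P (members P L)) (L.map Finset.card) out) ∧
    ∀ out, Run G p q ε (unionOf P (members P L)) (L.map Finset.card) out →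
      ∃ l : List (Finset (Fin n)), out = some l ∧
        (l : Multiset (Finset (Fin n))) = (L.map Finset.val).sum := by
  induction L with
  | nil =>
    refine ⟨⟨_, Run.done _⟩, fun out h => ?_⟩
    cases h
    exact ⟨[], rfl, rfl⟩
  | cons T L ih =>
    induction hk : T.card generalizing T with
    | zero =>
      obtain rfl := Finset.card_eq_zero.1 hk
      have hU : unionOf P (members P (∅ :: L)) = unionOf P (members P L) := by
        simp [members]
      obtain ⟨⟨out, hout⟩, hall⟩ := ih hL.tail
      simp only [List.map_cons, Finset.card_empty, hU]
      refine ⟨⟨out, Run.next _ _ _ hout⟩, fun out h => ?_⟩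
      cases h with
      | next _ _ _ h =>
        obtain ⟨l, hl, hl'⟩ := hall out h
        exact ⟨l, hl, by simpa using hl'⟩
    | succ k ihk =>
      obtain ⟨σ, hσ⟩ := isTypical_of_isRemaining hq hp hε hεp hg0 hg hlarge hG hL
        (Finset.card_pos.1 (by omega))
      have hsub := hL.subset T (by simp)
      have hmem : ∀ C ∈ T, C ∈ members P (T :: L) := fun C hC =>
        Finset.mem_filter.2 ⟨hsub hC, T, by simp, hC⟩
      have hext : ∀ (d : OrderedEigenbasis (bHat (G.induce
          (unionOf P (members P (T :: L)) : Set (Fin n))) p q)) v, IsPivot d ε (k + 1) v →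
          ∃ C ∈ T, (extracted d ε (k + 1) v).map (Function.Embedding.subtype _) = C := by
        intro d v hv
        rw [← hk] at hv ⊢
        obtain ⟨C, hC, hCe⟩ := hσ.extracted_eq_cluster d hv
        exact ⟨C, hC, by rw [hCe, map_cluster_label (hsub hC) (hmem C hC)]⟩
      have hstep : ∀ C ∈ T,
          (∃ out, Run G p q ε (unionOf P (members P (T :: L)) \ C) (k :: L.map Finset.card) out) ∧
          ∀ out, Run G p q ε (unionOf P (members P (T :: L)) \ C) (k :: L.map Finset.card) out →
          ∃ l : List (Finset (Fin n)), out = some l ∧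
            (l : Multiset (Finset (Fin n))) = (T.erase C).val + (L.map Finset.val).sum := by
        intro C hC
        have hcard : (T.erase C).card = k := by rw [Finset.card_erase_of_mem hC, hk]; rfl
        have := ihk (T.erase C) (hL.erase C) hcard
        rw [List.map_cons, hcard, ← unionOf_sdiff hL hC, List.map_cons, List.sum_cons] at this
        exact this
      rw [List.map_cons, hk]
      constructor
      · obtain ⟨d⟩ := OrderedEigenbasis.exists_of_isHermitian (isHermitian_bHat
          (G.induce (unionOf P (members P (T :: L)) : Set (Fin n))) p q)
        obtain ⟨v, hv, _⟩ := hσ.exists_admissible_long d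
        obtain ⟨w, hw⟩ := exists_isPivot d ⟨v, hv⟩
        rw [hk] at hw
        obtain ⟨C, hC, hCe⟩ := hext d w hw
        obtain ⟨⟨out, hout⟩, _⟩ := hstep C hC
        exact ⟨_, Run.extract _ k _ d w C out hw hCe.symm hout⟩
      · intro out h
        cases h with
        | fail _ _ _ d hfail =>
          obtain ⟨v, hv, _⟩ := hσ.exists_admissible_long d
          rw [hk] at hv
          exact absurd hv (hfail v)
        | extract _ _ _ d v C out hv hC hrun =>
          obtain ⟨C', hC', hCe⟩ := hext d v hv
          obtain rfl : C = C' := hC.trans hCe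
          obtain ⟨l, rfl, hl'⟩ := (hstep C hC').2 _ hrun
          refine ⟨C :: l, rfl, ?_⟩
          rw [← Multiset.cons_coe, hl', List.map_cons, List.sum_cons, ← Multiset.cons_add,
            Finset.erase_val, Multiset.cons_erase hC']

/-- On a good graph the algorithm recovers the clusters. -/
theorem recovers_of_isGoodGraph {G : SimpleGraph (Fin n)} {p q ε c : ℝ} (hq : 0 ≤ q) (hp : p ≤ 1)
    (hε : 0 < ε) (hεp : 100 * ε ≤ p - q) (hn : 0 < n) (hc0 : 0 < c)
    (hc : 10000 ≤ (p - q) * ε * c) {K : ℕ} {S : Fin K → Finset (Finset (Fin n))}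
    (hS : IsSuperclustering P S ε c) (hG : IsGoodGraph P G p q ε) :
    Recovers G p q ε (List.ofFn fun i => (S i).card) P := by
  have hn' : 0 < √(n : ℝ) := Real.sqrt_pos.2 (by exact_mod_cast hn)
  have hg0 : 0 < c * √(n : ℝ) := mul_pos hc0 hn'
  have hstep : ∀ k, ∀ i j : Fin K, (i : ℕ) + (k + 1) = j → ∀ C ∈ S i, ∀ D ∈ S j,
      (D.card : ℝ) + c * √(n : ℝ) ≤ C.card := by
    intro k
    induction k with
    | zero => intro i j hij; exact hS.separated i j hij
    | succ k ih =>
      intro i j hij C hC D hD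
      obtain ⟨E, hE⟩ := hS.nonempty ⟨i + (k + 1), by omega⟩
      have h1 := ih i ⟨i + (k + 1), by omega⟩ rfl C hC E hE
      have h2 := hS.separated ⟨i + (k + 1), by omega⟩ j (by simpa [add_assoc] using hij) E hE D hD
      linarith
  have hL : IsRemaining P (List.ofFn S) ε (c * √(n : ℝ)) := by
    constructor
    · intro T hT C hC
      obtain ⟨i, rfl⟩ := (List.mem_ofFn' _ _).1 hT
      exact (hS.cover C).2 ⟨i, hC⟩
    · rw [List.pairwise_ofFn]
      intro i j hij
      exact hS.disjoint i j hij.ne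
    · rw [List.pairwise_ofFn]
      intro i j hij
      have : (i : ℕ) < j := hij
      exact hstep (j - i - 1) i j (by omega)
    · intro T hT
      obtain ⟨i, rfl⟩ := (List.mem_ofFn' _ _).1 hT
      exact hS.within i
  have key := run_correct hq hp hε hεp hg0
    (by calc 10000 * √(n : ℝ) ≤ ((p - q) * ε * c) * √(n : ℝ) := by gcongr
          _ = _ := by ring) hS.large hG _ hL
  have hU : unionOf P (members P (List.ofFn S)) = Finset.univ := by
    ext v
    have hv : P.part v ∈ P.parts := P.part_mem.2 (Finset.mem_univ v)
    obtain ⟨i, hi⟩ := (hS.cover _).1 hv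
    simp only [unionOf, members, Finset.mem_filter, Finset.mem_univ, true_and, iff_true]
    exact ⟨hv, S i, (List.mem_ofFn' _ _).2 ⟨i, rfl⟩, hi⟩
  have hsum : ((List.ofFn S).map Finset.val).sum = P.parts.val := by
    have hdis : ((Finset.univ : Finset (Fin K)) : Set (Fin K)).PairwiseDisjoint S :=
      fun i _ j _ hij => hS.disjoint i j hij
    have h1 : P.parts = Finset.univ.disjiUnion S hdis := by
      ext C
      rw [Finset.mem_disjiUnion, hS.cover C]
      simp
    rw [h1, List.map_ofFn, List.sum_ofFn]
    simp [Finset.disjiUnion, Multiset.bind, Multiset.join, Finset.sum]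
  have hks : (List.ofFn S).map Finset.card = List.ofFn fun i => (S i).card := by
    rw [List.map_ofFn]; rfl
  rw [hU, hsum, hks] at key
  exact key

end Correctness

/-! ### Concentration of weighted sums of coins -/

section Coins

open MeasureTheory ProbabilityTheory

/-- The value of a coin, as a real number. -/
def coinVal (b : Prop) : ℝ := open scoped Classical in if b then 1 else 0

lemma measurable_coinVal : Measurable coinVal := measurable_of_countable _

lemma coinVal_mem_Icc (b : Prop) : coinVal b ∈ Set.Icc (0 : ℝ) 1 := by
  unfold coinVal
  split_ifs <;> simp

lemma isProbabilityMeasure_coin {r : ℝ} (h0 : 0 ≤ r) (h1 : r ≤ 1) :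
    IsProbabilityMeasure (coin r) := by
  constructor
  simp only [coin, Measure.add_apply, Measure.smul_apply, measure_univ, smul_eq_mul, mul_one]
  rw [← ENNReal.ofReal_add h0 (by linarith)]
  simp

lemma integral_coinVal {r : ℝ} (h0 : 0 ≤ r) : ∫ b, coinVal b ∂(coin r) = r := by
  have hi : ∀ b : Prop, Integrable coinVal (Measure.dirac b) := fun b =>
    Integrable.of_mem_Icc 0 1 measurable_coinVal.aemeasurable (ae_of_all _ coinVal_mem_Icc)
  rw [coin, integral_add_measure ((hi _).smul_measure ENNReal.ofReal_ne_top)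
    ((hi _).smul_measure ENNReal.ofReal_ne_top), integral_smul_measure, integral_smul_measure,
    integral_dirac, integral_dirac]
  simp [coinVal, h0]

variable {E : Type*} [Fintype E] {r : E → ℝ}

/-- Hoeffding's inequality for a weighted sum of independent centred coins. -/
lemma measure_weighted_coins_ge_le (h0 : ∀ e, 0 ≤ r e) (h1 : ∀ e, r e ≤ 1) (a : E → ℝ) {s t : ℝ}
    (hs : ∑ e, a e ^ 2 ≤ s) (ht : 0 < t) :
    (Measure.pi fun e => coin (r e)).real {ω | t ≤ ∑ e, a e * (coinVal (ω e) - r e)} ≤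
      Real.exp (-(2 * t ^ 2 / s)) := by
  have hprob : ∀ e, IsProbabilityMeasure (coin (r e)) := fun e =>
    isProbabilityMeasure_coin (h0 e) (h1 e)
  set μ := Measure.pi fun e => coin (r e) with hμ
  -- The Chernoff bound has a junk value if all weights vanish.
  rcases (Finset.sum_nonneg fun e _ => sq_nonneg (a e) : 0 ≤ ∑ e, a e ^ 2).eq_or_lt with hz | hpos
  · have ha : ∀ e, a e = 0 := fun e => by
      have := (Finset.sum_eq_zero_iff_of_nonneg fun e _ => sq_nonneg (a e)).1 hz.symm e
        (Finset.mem_univ e)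
      exact pow_eq_zero_iff (two_ne_zero) |>.1 this
    have : {ω : E → Prop | t ≤ ∑ e, a e * (coinVal (ω e) - r e)} = ∅ := by
      ext ω
      simp [ha, ht]
    rw [this]
    simp only [measureReal_empty]
    positivity
  have hcoin : ∀ e, HasSubgaussianMGF (fun b => coinVal b - r e) ((‖(1 : ℝ) - 0‖₊ / 2) ^ 2)
      (coin (r e)) := by
    intro e
    have := hasSubgaussianMGF_of_mem_Icc (μ := coin (r e)) (X := coinVal) (a := 0) (b := 1)
      measurable_coinVal.aemeasurable (ae_of_all _ coinVal_mem_Icc)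
    rwa [integral_coinVal (h0 e)] at this
  have hsub : ∀ e, HasSubgaussianMGF (fun ω : E → Prop => a e * (coinVal (ω e) - r e))
      (⟨a e ^ 2, sq_nonneg _⟩ * (‖(1 : ℝ) - 0‖₊ / 2) ^ 2) μ := by
    intro e
    have hmap : μ.map (Function.eval e) = coin (r e) := (measurePreserving_eval _ e).map_eq
    have h2 : HasSubgaussianMGF ((fun b => coinVal b - r e) ∘ Function.eval e)
        ((‖(1 : ℝ) - 0‖₊ / 2) ^ 2) μ :=
      HasSubgaussianMGF.of_map (measurable_pi_apply e).aemeasurable (by rw [hmap]; exact hcoin e)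
    exact h2.const_mul (a e)
  have hind : iIndepFun (fun e (ω : E → Prop) => a e * (coinVal (ω e) - r e)) μ :=
    iIndepFun_pi (X := fun e b => a e * (coinVal b - r e))
      fun e => (measurable_of_countable _).aemeasurable
  have key := HasSubgaussianMGF.measure_sum_ge_le_of_iIndepFun hind (s := Finset.univ)
    (fun e _ => hsub e) ht.le
  refine key.trans (Real.exp_le_exp.2 ?_)
  have hc : ((∑ e, (⟨a e ^ 2, sq_nonneg _⟩ * (‖(1 : ℝ) - 0‖₊ / 2) ^ 2) : NNReal) : ℝ) =
      (∑ e, a e ^ 2) / 4 := by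
    push_cast
    rw [Finset.sum_div]
    refine Finset.sum_congr rfl fun e _ => ?_
    change a e ^ 2 * (((‖(1 : ℝ) - 0‖₊ / 2) ^ 2 : NNReal) : ℝ) = _
    simp
    ring
  rw [hc, neg_div, neg_le_neg_iff]
  calc 2 * t ^ 2 / s ≤ 2 * t ^ 2 / ∑ e, a e ^ 2 := by gcongr
    _ = _ := by field_simp; ring

end Coins

/-! ### Nets of the unit sphere -/

section Nets

variable {V : Type*} [Fintype V] [DecidableEq V]

/-- The unit sphere of an `m`-dimensional Euclidean space has a `1/2`-net with at most `5 ^ m`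
points. -/
lemma exists_net (V : Type*) [Fintype V] : ∃ N : Finset (EuclideanSpace ℝ V),
    N.card ≤ 5 ^ Fintype.card V ∧ (∀ y ∈ N, ‖y‖ = 1) ∧ ∀ x, ‖x‖ = 1 → ∃ y ∈ N, ‖x - y‖ < 1 / 2 := by
  classical
  let Sep : Finset (EuclideanSpace ℝ V) → Prop := fun N =>
    (∀ y ∈ N, ‖y‖ = 1) ∧ ∀ y ∈ N, ∀ z ∈ N, y ≠ z → 1 / 2 ≤ ‖y - z‖
  have hbound : ∀ N, Sep N → N.card ≤ 5 ^ Fintype.card V := by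
    intro N hN
    have h := Besicovitch.card_le_of_separated (N.image fun y => (2 : ℝ) • y) (by
      intro c hc
      obtain ⟨y, hy, rfl⟩ := Finset.mem_image.1 hc
      rw [norm_smul, hN.1 y hy]
      norm_num) (by
      intro c hc d hd hcd
      obtain ⟨y, hy, rfl⟩ := Finset.mem_image.1 hc
      obtain ⟨z, hz, rfl⟩ := Finset.mem_image.1 hd
      have := hN.2 y hy z hz (fun h => hcd (by rw [h]))
      rw [← smul_sub, norm_smul, Real.norm_eq_abs, abs_two]
      linarith)
    rw [Finset.card_image_of_injective _ (smul_right_injective _ two_ne_zero),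
      finrank_euclideanSpace] at h
    exact h
  -- A separated set of maximal cardinality is a net.
  have hmem := Nat.sSup_mem (s := {k | ∃ N, Sep N ∧ N.card = k}) ⟨0, ∅, by simp [Sep], rfl⟩
    ⟨5 ^ Fintype.card V, by rintro k ⟨N, hN, rfl⟩; exact hbound N hN⟩
  obtain ⟨N, hN, hcard⟩ := hmem
  refine ⟨N, hbound N hN, hN.1, fun x hx => ?_⟩
  by_contra! hfar
  have hxN : x ∉ N := fun h => by
    have := hfar x h
    norm_num at this
  have hins : Sep (insert x N) := by
    constructor
    · intro y hy
      rcases Finset.mem_insert.1 hy with rfl | hy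
      · exact hx
      · exact hN.1 y hy
    · intro y hy z hz hyz
      rcases Finset.mem_insert.1 hy with hy' | hy' <;>
        rcases Finset.mem_insert.1 hz with hz' | hz'
      · exact absurd (hy'.trans hz'.symm) hyz
      · rw [hy']; exact hfar z hz'
      · rw [hz', norm_sub_rev]; exact hfar y hy'
      · exact hN.2 y hy' z hz' hyz
  have hle : (insert x N).card ≤ sSup {k | ∃ N, Sep N ∧ N.card = k} :=
    le_csSup ⟨5 ^ Fintype.card V, by rintro k ⟨N, hN, rfl⟩; exact hbound N hN⟩ ⟨_, hins, rfl⟩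
  rw [Finset.card_insert_of_notMem hxN] at hle
  omega

/-- The norm of a symmetric matrix is controlled by its quadratic form on a `1/2`-net of the unit
sphere: a point of the net near a unit eigenvector for the eigenvalue `l` of largest modulus has
inner product at least `7/8` with it, so that the quadratic form has modulus at least
`(2 * (7/8) ^ 2 - 1) * |l| = 17/32 * |l|` there. -/
lemma opNorm_le_of_net {A : Matrix V V ℝ} (hA : A.IsHermitian) {N : Finset (EuclideanSpace ℝ V)}
    (hN1 : ∀ y ∈ N, ‖y‖ = 1) (hN : ∀ x, ‖x‖ = 1 → ∃ y ∈ N, ‖x - y‖ < 1 / 2) {s : ℝ} (hs : 0 ≤ s)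
    (h : ∀ y ∈ N, |y.ofLp ⬝ᵥ A *ᵥ y.ofLp| ≤ 17 / 32 * s) : ‖A‖ ≤ s := by
  obtain ⟨d⟩ := OrderedEigenbasis.exists_of_isHermitian hA
  rw [d.eq_fn_val]
  refine d.norm_fn_le hs fun i₀ => ?_
  have : Nonempty (Fin (Fintype.card V)) := ⟨i₀⟩
  obtain ⟨i, hi⟩ := Finite.exists_max fun i => |d.val i|
  refine (hi i₀).trans ?_
  have hvi : ‖d.vec i‖ = 1 := d.vec.orthonormal.1 i
  obtain ⟨y, hy, hclose⟩ := hN (d.vec i) hvi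
  have hy1 := hN1 y hy
  set t := (d.vec i).ofLp ⬝ᵥ y.ofLp with ht
  have ht' : inner ℝ (d.vec i) y = t := by
    rw [real_inner_comm, EuclideanSpace.inner_eq_star_dotProduct]
    simp [ht]
  have ht78 : 7 / 8 ≤ t := by
    have h1 := norm_sub_sq_real (d.vec i) y
    rw [hvi, hy1, ht'] at h1
    have h2 : ‖d.vec i - y‖ ^ 2 ≤ (1 / 2) ^ 2 := pow_le_pow_left₀ (norm_nonneg _) hclose.le 2
    linarith
  have hsum : ∑ j, ((d.vec j).ofLp ⬝ᵥ y.ofLp) ^ 2 = 1 := by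
    rw [← d.dotProduct_self_eq, dotProduct_self_eq_norm_sq]
    simp [hy1]
  have hq := h y hy
  rw [d.quadForm_eq, ← Finset.add_sum_erase _ _ (Finset.mem_univ i)] at hq
  rw [← Finset.add_sum_erase _ _ (Finset.mem_univ i)] at hsum
  -- The other eigenvectors contribute at most `|l| * (1 - t ^ 2)` by maximality of `|l|`.
  have hrest : |∑ j ∈ Finset.univ.erase i, d.val j * ((d.vec j).ofLp ⬝ᵥ y.ofLp) ^ 2| ≤
      |d.val i| * (1 - t ^ 2) := by
    refine (Finset.abs_sum_le_sum_abs _ _).trans ?_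
    have : 1 - t ^ 2 = ∑ j ∈ Finset.univ.erase i, ((d.vec j).ofLp ⬝ᵥ y.ofLp) ^ 2 := by linarith
    rw [this, Finset.mul_sum]
    refine Finset.sum_le_sum fun j _ => ?_
    rw [abs_mul, abs_of_nonneg (sq_nonneg ((d.vec j).ofLp ⬝ᵥ y.ofLp))]
    have := hi j
    gcongr
  have h1 := abs_sub_abs_le_abs_sub (d.val i * t ^ 2)
    (-∑ j ∈ Finset.univ.erase i, d.val j * ((d.vec j).ofLp ⬝ᵥ y.ofLp) ^ 2)
  rw [sub_neg_eq_add, abs_neg, abs_mul, abs_of_nonneg (sq_nonneg t)] at h1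
  have h2 : |d.val i| * (17 / 32) ≤ |d.val i| * (2 * t ^ 2 - 1) := by
    gcongr
    nlinarith
  linarith

end Nets

/-! ### The spectral norm of the centred adjacency matrix -/

section SpectralNorm

open MeasureTheory

variable {n : ℕ} {r : Sym2 (Fin n) → ℝ}

/-- The centred adjacency matrix, on the vertex set `U`. -/
def noise (r : Sym2 (Fin n) → ℝ) (ω : Sym2 (Fin n) → Prop) (U : Finset (Fin n)) :
    Matrix (U : Set (Fin n)) (U : Set (Fin n)) ℝ :=
  Matrix.of fun u v => if u = v then 0 else coinVal (ω s(u.1, v.1)) - r s(u.1, v.1)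

lemma isHermitian_noise (ω : Sym2 (Fin n) → Prop) (U : Finset (Fin n)) :
    (noise r ω U).IsHermitian := by
  ext u v
  simp only [noise, Matrix.conjTranspose_apply, Matrix.of_apply, star_trivial]
  rw [Sym2.eq_swap]
  simp only [eq_comm]

/-- The coefficient of the pair `e` in the quadratic form of a symmetric matrix with zero
diagonal, at the vector `y`. -/
def pairCoeff (U : Finset (Fin n)) (y : ↥(U : Set (Fin n)) → ℝ) (e : Sym2 (Fin n)) : ℝ :=
  ∑ x : ↥(U : Set (Fin n)) × ↥(U : Set (Fin n)) with s(x.1.1, x.2.1) = e,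
    if x.1 = x.2 then 0 else y x.1 * y x.2

lemma quadForm_noise (ω : Sym2 (Fin n) → Prop) (U : Finset (Fin n))
    (y : ↥(U : Set (Fin n)) → ℝ) :
    y ⬝ᵥ noise r ω U *ᵥ y = ∑ e, pairCoeff U y e * (coinVal (ω e) - r e) := by
  have h1 : y ⬝ᵥ noise r ω U *ᵥ y = ∑ x : ↥(U : Set (Fin n)) × ↥(U : Set (Fin n)),
      (if x.1 = x.2 then 0 else y x.1 * y x.2) *
        (coinVal (ω s(x.1.1, x.2.1)) - r s(x.1.1, x.2.1)) := by
    rw [Fintype.sum_prod_type]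
    simp only [dotProduct, Matrix.mulVec, Finset.mul_sum, noise, Matrix.of_apply]
    refine Finset.sum_congr rfl fun u _ => Finset.sum_congr rfl fun v _ => ?_
    split_ifs
    · simp
    · ring
  rw [h1, ← Finset.sum_fiberwise _
    fun x : ↥(U : Set (Fin n)) × ↥(U : Set (Fin n)) => s(x.1.1, x.2.1)]
  refine Finset.sum_congr rfl fun e _ => ?_
  rw [pairCoeff, Finset.sum_mul]
  refine Finset.sum_congr rfl fun x hx => ?_
  rw [(Finset.mem_filter.1 hx).2]

lemma sum_sq_pairCoeff_le (U : Finset (Fin n)) (y : ↥(U : Set (Fin n)) → ℝ) :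
    ∑ e, pairCoeff U y e ^ 2 ≤ 2 * (∑ u, y u ^ 2) ^ 2 := by
  -- A pair comes from at most two ordered pairs.
  have hfib : ∀ e : Sym2 (Fin n),
      (Finset.univ.filter fun x : ↥(U : Set (Fin n)) × ↥(U : Set (Fin n)) =>
        s(x.1.1, x.2.1) = e).card ≤ 2 := by
    intro e
    induction e with
    | _ a b =>
      calc _ ≤ ({(a, b), (b, a)} : Finset (Fin n × Fin n)).card := by
            refine Finset.card_le_card_of_injOn (fun x => (x.1.1, x.2.1)) ?_ ?_
            · intro x hx
              have := (Finset.mem_filter.1 (Finset.mem_coe.1 hx)).2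
              rcases Sym2.eq_iff.1 this with ⟨h1, h2⟩ | ⟨h1, h2⟩ <;> simp [h1, h2]
            · intro x _ z _ hxz
              have := Prod.ext_iff.1 hxz
              exact Prod.ext (Subtype.ext this.1) (Subtype.ext this.2)
        _ ≤ 2 := Finset.card_le_two
  have h1 : ∀ e, pairCoeff U y e ^ 2 ≤
      2 * ∑ x : ↥(U : Set (Fin n)) × ↥(U : Set (Fin n)) with s(x.1.1, x.2.1) = e,
        (y x.1 * y x.2) ^ 2 := by
    intro e
    refine (sq_sum_le_card_mul_sum_sq).trans ?_
    refine mul_le_mul (by exact_mod_cast hfib e) (Finset.sum_le_sum fun x _ => ?_)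
      (Finset.sum_nonneg fun _ _ => sq_nonneg _) zero_le_two
    split_ifs
    · rw [zero_pow two_ne_zero]
      exact sq_nonneg _
    · exact le_rfl
  calc _ ≤ ∑ e, 2 * ∑ x : ↥(U : Set (Fin n)) × ↥(U : Set (Fin n)) with s(x.1.1, x.2.1) = e,
        (y x.1 * y x.2) ^ 2 := Finset.sum_le_sum fun e _ => h1 e
    _ = 2 * ∑ x : ↥(U : Set (Fin n)) × ↥(U : Set (Fin n)), (y x.1 * y x.2) ^ 2 := by
        rw [← Finset.mul_sum, Finset.sum_fiberwise]
    _ = 2 * (∑ u, y u ^ 2) ^ 2 := by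
        rw [Fintype.sum_prod_type, sq (∑ u, y u ^ 2), Finset.sum_mul_sum]
        simp only [mul_pow]

/-- The spectral norm of the noise on `m` vertices exceeds `7 √m` with exponentially small
probability. -/
lemma measure_norm_noise_gt_le (h0 : ∀ e, 0 ≤ r e) (h1 : ∀ e, r e ≤ 1) (U : Finset (Fin n))
    (hU : U.Nonempty) :
    (Measure.pi fun e => coin (r e)).real {ω | 7 * √(U.card : ℝ) < ‖noise r ω U‖} ≤
      2 * Real.exp (-(11 * U.card)) := by
  have hprob : ∀ e, IsProbabilityMeasure (coin (r e)) := fun e =>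
    isProbabilityMeasure_coin (h0 e) (h1 e)
  set μ := Measure.pi fun e => coin (r e) with hμ
  have hμ1 : IsProbabilityMeasure μ := by rw [hμ]; infer_instance
  obtain ⟨N, hNcard, hN1, hN⟩ := exists_net (U : Set (Fin n))
  have hcardU : Fintype.card (U : Set (Fin n)) = U.card := by simp
  rw [hcardU] at hNcard
  have hUpos : (0 : ℝ) < U.card := by exact_mod_cast hU.card_pos
  set s : ℝ := 17 / 32 * (7 * √(U.card : ℝ)) with hs
  have hs0 : 0 < s := by have := Real.sqrt_pos.2 hUpos; positivity
  have hone : ∀ y ∈ N, ∀ σ : ℝ, σ ^ 2 = 1 →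
      μ.real {ω | s ≤ ∑ e, (σ * pairCoeff U y.ofLp e) * (coinVal (ω e) - r e)} ≤
        Real.exp (-(13 * U.card)) := by
    intro y hy σ hσ
    have hsum : ∑ e, (σ * pairCoeff U y.ofLp e) ^ 2 ≤ 2 := by
      simp only [mul_pow, hσ, one_mul]
      refine (sum_sq_pairCoeff_le U y.ofLp).trans ?_
      rw [← norm_toLp_sq]
      have : ‖WithLp.toLp 2 y.ofLp‖ = 1 := hN1 y hy
      rw [this]
      norm_num
    refine (measure_weighted_coins_ge_le h0 h1 _ hsum hs0).trans (Real.exp_le_exp.2 ?_)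
    have : s ^ 2 = (17 / 32 * 7) ^ 2 * U.card := by
      rw [hs, mul_pow, mul_pow, Real.sq_sqrt hUpos.le]; ring
    rw [this]
    linarith
  have hsubset : {ω | 7 * √(U.card : ℝ) < ‖noise r ω U‖} ⊆ ⋃ y ∈ N,
      ({ω | s ≤ ∑ e, (1 * pairCoeff U y.ofLp e) * (coinVal (ω e) - r e)} ∪
        {ω | s ≤ ∑ e, (-1 * pairCoeff U y.ofLp e) * (coinVal (ω e) - r e)}) := by
    intro ω hω
    by_contra hcon
    simp only [Set.mem_iUnion, Set.mem_union, Set.mem_ofPred_eq, exists_prop, not_exists, not_and,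
      not_or, not_le] at hcon
    have hω' : 7 * √(U.card : ℝ) < ‖noise r ω U‖ := hω
    refine absurd hω' (not_lt.2 ?_)
    refine opNorm_le_of_net (isHermitian_noise ω U) hN1 hN (by positivity) fun y hy => ?_
    obtain ⟨c1, c2⟩ := hcon y hy
    rw [quadForm_noise, abs_le]
    simp only [one_mul, neg_mul, Finset.sum_neg_distrib] at c1 c2
    exact ⟨by linarith, by linarith⟩
  calc μ.real {ω | 7 * √(U.card : ℝ) < ‖noise r ω U‖}
      ≤ ∑ y ∈ N, μ.real
        ({ω | s ≤ ∑ e, (1 * pairCoeff U y.ofLp e) * (coinVal (ω e) - r e)} ∪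
        {ω | s ≤ ∑ e, (-1 * pairCoeff U y.ofLp e) * (coinVal (ω e) - r e)}) :=
        (measureReal_mono hsubset (measure_ne_top _ _)).trans (measureReal_biUnion_finset_le _ _)
    _ ≤ ∑ y ∈ N, 2 * Real.exp (-(13 * U.card)) := by
        refine Finset.sum_le_sum fun y hy => (measureReal_union_le _ _).trans ?_
        linarith [hone y hy 1 (by norm_num), hone y hy (-1) (by norm_num)]
    _ = N.card * (2 * Real.exp (-(13 * U.card))) := by simp
    _ ≤ Real.exp (2 * U.card) * (2 * Real.exp (-(13 * U.card))) := by
        gcongr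
        calc (N.card : ℝ) ≤ 5 ^ U.card := by exact_mod_cast hNcard
          _ ≤ (Real.exp 2) ^ U.card := by
            gcongr
            have := Real.quadratic_le_exp_of_nonneg (x := 2) (by norm_num)
            linarith
          _ = Real.exp (2 * U.card) := by rw [← Real.exp_nat_mul, mul_comm]
    _ = 2 * Real.exp (-(11 * U.card)) := by
        rw [mul_left_comm, ← Real.exp_add]
        congr 2
        ring

end SpectralNorm

/-! ### The random graph is good with overwhelming probability -/

section RandomGraph

open MeasureTheory

variable {n : ℕ} {P : Finpartition (Finset.univ : Finset (Fin n))} {p q ε : ℝ}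

lemma edgeProb_mk (u v : Fin n) :
    edgeProb P p q s(u, v) = if P.part u = P.part v then p else q := by
  unfold edgeProb
  refine if_congr ?_ rfl rfl
  simp only [Sym2.mem_iff, forall_eq_or_imp, forall_eq]
  constructor
  · rintro ⟨C, hC, hu, hv⟩
    rw [(part_eq_iff hC).2 hu, (part_eq_iff hC).2 hv]
  · intro h
    exact ⟨P.part u, P.part_mem.2 (Finset.mem_univ u), P.mem_part (Finset.mem_univ u),
      h ▸ P.mem_part (Finset.mem_univ v)⟩

lemma edgeProb_nonneg (hq : 0 ≤ q) (hqp : q ≤ p) (e : Sym2 (Fin n)) : 0 ≤ edgeProb P p q e := by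
  unfold edgeProb
  split_ifs <;> linarith

lemma edgeProb_le_one (hqp : q ≤ p) (hp : p ≤ 1) (e : Sym2 (Fin n)) : edgeProb P p q e ≤ 1 := by
  unfold edgeProb
  split_ifs <;> linarith

/-- The graph in which the pairs whose coins show `True` are the edges. -/
def coinGraph (ω : Sym2 (Fin n) → Prop) : SimpleGraph (Fin n) := SimpleGraph.fromEdgeSet {e | ω e}

lemma coinGraph_adj {ω : Sym2 (Fin n) → Prop} {u v : Fin n} :
    (coinGraph ω).Adj u v ↔ ω s(u, v) ∧ u ≠ v := by
  simp [coinGraph]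

/-- On every set of vertices, the matrix `B̂` minus its expectation is the centred adjacency
matrix; the diagonal term `p I` makes the expectation exactly block-constant. -/
lemma bHat_sub_clusterMatrix (ω : Sym2 (Fin n) → Prop) (U : Finset (Fin n)) :
    (bHat ((coinGraph ω).induce (U : Set (Fin n))) p q -
      clusterMatrix (label P U) fun C => (p - q) * (cluster (label P U) C).card) =
    noise (edgeProb P p q) ω U := by
  ext u v
  have hpos := (card_cluster_pos (label P U) u).ne'
  have hlabel : label P U u = label P U v ↔ P.part u = P.part v := Iff.rfl
  simp only [Matrix.sub_apply, clusterMatrix_apply, noise, Matrix.of_apply, bHat, Matrix.add_apply,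
    Matrix.smul_apply, SimpleGraph.adjMatrix_apply, SimpleGraph.comap_adj, Matrix.one_apply,
    smul_eq_mul, mul_one, mul_div_cancel_right₀ _ hpos, edgeProb_mk, hlabel,
    Function.Embedding.subtype_apply, coinVal]
  by_cases huv : u = v
  · simp [huv]
  · by_cases h1 : P.part u = P.part v <;> by_cases h2 : ω s(u.1, v.1) <;>
      simp [huv, h1, h2, coinGraph_adj]
    ring

lemma ncard_neighbours (ω : Sym2 (Fin n) → Prop) (u : Fin n) (C : Finset (Fin n)) :
    (Set.ncard {w | w ∈ C ∧ (coinGraph ω).Adj u w} : ℝ) =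
      ∑ w ∈ C.erase u, coinVal (ω s(u, w)) := by
  classical
  have h : {w | w ∈ C ∧ (coinGraph ω).Adj u w} =
      (((C.erase u).filter fun w => ω s(u, w) : Finset (Fin n)) : Set (Fin n)) := by
    ext w
    simp only [Set.mem_ofPred_eq, coinGraph_adj, Finset.coe_filter, Finset.mem_erase, ne_comm]
    tauto
  rw [h, Set.ncard_coe_finset]
  simp only [coinVal]
  rw [Finset.sum_boole]

/-- Hoeffding's inequality for the number of neighbours that `u` has in `C`. -/
lemma measure_degree_deviation_le {r : Sym2 (Fin n) → ℝ} (h0 : ∀ e, 0 ≤ r e) (h1 : ∀ e, r e ≤ 1)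
    (u : Fin n) (C : Finset (Fin n)) {σ t : ℝ} (hσ : σ ^ 2 = 1) (ht : 0 < t) :
    (Measure.pi fun e => coin (r e)).real
      {ω | t ≤ σ * ∑ w ∈ C.erase u, (coinVal (ω s(u, w)) - r s(u, w))} ≤
      Real.exp (-(2 * t ^ 2 / C.card)) := by
  have hinj : Set.InjOn (fun w => s(u, w)) (C.erase u : Finset (Fin n)) :=
    fun w _ w' _ h => Sym2.congr_right.1 h
  set F := (C.erase u).image fun w => s(u, w) with hF
  have hsum : ∑ e, (if e ∈ F then σ else 0) ^ 2 ≤ (C.card : ℝ) := by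
    have : ∀ e, (if e ∈ F then σ else 0) ^ 2 = if e ∈ F then (1 : ℝ) else 0 := by
      intro e
      split_ifs <;> simp [hσ]
    simp only [this]
    rw [Finset.sum_boole, Finset.filter_univ_mem]
    exact_mod_cast Finset.card_image_le.trans (Finset.card_erase_le)
  have key := measure_weighted_coins_ge_le h0 h1 _ hsum ht
  refine le_of_eq_of_le ?_ key
  congr 1
  ext ω
  simp only [Set.mem_ofPred_eq, ite_mul, zero_mul]
  rw [Finset.sum_ite_mem, Finset.univ_inter, hF, Finset.sum_image hinj, Finset.mul_sum]

lemma subset_unionOf {𝒟 : Finset (Finset (Fin n))} {C : Finset (Fin n)} (hC : C ∈ P.parts)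
    (hD : C ∈ 𝒟) : C ⊆ unionOf P 𝒟 := by
  intro v hv
  simp [unionOf, (part_eq_iff hC).2 hv, hD]

/-- The random graph is good with overwhelming probability. The spectral condition is required for
at most `2 ^ √n` unions of clusters, each of which has at least `√n` vertices. -/
lemma measure_not_isGoodGraph_le (hq : 0 ≤ q) (hqp : q ≤ p) (hp : p ≤ 1) (hε : 0 < ε)
    (hsize : ∀ C ∈ P.parts, √(n : ℝ) ≤ C.card) (hsize2 : ∀ C ∈ P.parts, 2 ≤ ε * C.card) :
    (Measure.pi fun e : Sym2 (Fin n) => coin (edgeProb P p q e)).real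
      {ω | ¬ IsGoodGraph P (coinGraph ω) p q ε} ≤
      2 * Real.exp (-(10 * √(n : ℝ))) + n ^ 2 * Real.exp (-(ε ^ 2 / 2 * √(n : ℝ))) := by
  set r := edgeProb P p q with hr
  have h0 : ∀ e, 0 ≤ r e := edgeProb_nonneg hq hqp
  have h1 : ∀ e, r e ≤ 1 := edgeProb_le_one hqp hp
  have hprob : ∀ e, IsProbabilityMeasure (coin (r e)) := fun e =>
    isProbabilityMeasure_coin (h0 e) (h1 e)
  set μ := Measure.pi fun e => coin (r e) with hμ
  have hμ1 : IsProbabilityMeasure μ := by rw [hμ]; infer_instance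
  have hcard : P.parts.card ≤ n := by simpa using P.card_parts_le_card
  have hcard2 : (P.parts.card : ℝ) ≤ √(n : ℝ) := by
    rcases Nat.eq_zero_or_pos n with hn | hn
    · have : P.parts.card = 0 := by omega
      rw [this]; simp
    have hn' : 0 < √(n : ℝ) := Real.sqrt_pos.2 (by exact_mod_cast hn)
    have h2 : ∑ C ∈ P.parts, √(n : ℝ) ≤ ∑ C ∈ P.parts, (C.card : ℝ) := Finset.sum_le_sum hsize
    rw [← Nat.cast_sum, P.sum_card_parts, Finset.sum_const, nsmul_eq_mul, Finset.card_univ,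
      Fintype.card_fin] at h2
    have h3 : (P.parts.card : ℝ) * √(n : ℝ) ≤ √(n : ℝ) * √(n : ℝ) := by
      rwa [Real.mul_self_sqrt (Nat.cast_nonneg n)]
    exact le_of_mul_le_mul_right h3 hn'
  classical
  let sgn : Fin n → Finset (Fin n) → ℝ := fun u C => if u ∈ C then -1 else 1
  let A : Finset (Finset (Fin n)) → Set (Sym2 (Fin n) → Prop) := fun 𝒟 =>
    {ω | 7 * √((unionOf P 𝒟).card : ℝ) < ‖noise r ω (unionOf P 𝒟)‖}
  let B : Fin n → Finset (Fin n) → Set (Sym2 (Fin n) → Prop) := fun u C =>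
    {ω | ε / 2 * C.card ≤ sgn u C * ∑ w ∈ C.erase u, (coinVal (ω s(u, w)) - r s(u, w))}
  have hsub : {ω | ¬ IsGoodGraph P (coinGraph ω) p q ε} ⊆
      (⋃ 𝒟 ∈ P.parts.powerset.filter Finset.Nonempty, A 𝒟) ∪
      ⋃ x ∈ (Finset.univ : Finset (Fin n)) ×ˢ P.parts, B x.1 x.2 := by
    intro ω hω
    by_contra hcon
    simp only [Set.mem_union, Set.mem_iUnion, exists_prop, not_or, not_exists, not_and,
      Finset.mem_filter, Finset.mem_powerset, Finset.mem_product, Finset.mem_univ, true_and,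
      Prod.forall, and_imp] at hcon
    obtain ⟨hA, hB⟩ := hcon
    have hB' : ∀ u, ∀ C ∈ P.parts, sgn u C *
        ((Set.ncard {w | w ∈ C ∧ (coinGraph ω).Adj u w} : ℝ) - ∑ w ∈ C.erase u, r s(u, w)) <
        ε / 2 * C.card := by
      intro u C hC
      rw [ncard_neighbours, ← Finset.sum_sub_distrib]
      exact not_le.1 (hB u C hC)
    refine hω ⟨fun 𝒟 hD hne => ?_, fun u C hC hu => ?_, fun u C hC hu => ?_⟩
    · rw [bHat_sub_clusterMatrix]
      have h : ¬ 7 * √((unionOf P 𝒟).card : ℝ) < ‖noise r ω (unionOf P 𝒟)‖ := hA 𝒟 hD hne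
      simpa using not_lt.1 h
    · have h := hB' u C hC
      -- The expected number is `p (|C| - 1)`; the missing `p` is absorbed by `ε |C| / 2 ≥ 1`.
      have hsum : ∑ w ∈ C.erase u, r s(u, w) = (C.card - 1) * p := by
        have : ∀ w ∈ C.erase u, r s(u, w) = p := by
          intro w hw
          rw [hr, edgeProb_mk, if_pos]
          rw [(part_eq_iff hC).2 hu, (part_eq_iff hC).2 (Finset.mem_of_mem_erase hw)]
        rw [Finset.sum_congr rfl this, Finset.sum_const, nsmul_eq_mul, Finset.card_erase_of_mem hu,
          Nat.cast_sub (Finset.card_pos.2 ⟨u, hu⟩)]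
        simp
      have hs : sgn u C = -1 := if_pos hu
      rw [hsum, hs] at h
      linarith [hsize2 C hC]
    · have h := hB' u C hC
      have hsum : ∑ w ∈ C.erase u, r s(u, w) = C.card * q := by
        rw [Finset.erase_eq_of_notMem hu]
        have : ∀ w ∈ C, r s(u, w) = q := by
          intro w hw
          rw [hr, edgeProb_mk, if_neg]
          rw [(part_eq_iff hC).2 hw, part_eq_iff hC]
          exact hu
        rw [Finset.sum_congr rfl this, Finset.sum_const, nsmul_eq_mul]
      have hs : sgn u C = 1 := if_neg hu
      rw [hsum, hs] at h
      have : 0 ≤ ε * (C.card : ℝ) := by positivity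
      linarith
  have hA : ∀ 𝒟 ∈ P.parts.powerset.filter Finset.Nonempty,
      μ.real (A 𝒟) ≤ 2 * Real.exp (-(11 * √(n : ℝ))) := by
    intro 𝒟 hD
    obtain ⟨hD, C, hC⟩ := Finset.mem_filter.1 hD
    have hCP := Finset.mem_powerset.1 hD hC
    have hCU := subset_unionOf hCP hC
    have hne := (P.nonempty_of_mem_parts hCP).mono hCU
    refine (measure_norm_noise_gt_le h0 h1 _ hne).trans ?_
    have h2 : (C.card : ℝ) ≤ (unionOf P 𝒟).card := by exact_mod_cast Finset.card_le_card hCU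
    have h3 := (hsize C hCP).trans h2
    gcongr
  have hB : ∀ x ∈ (Finset.univ : Finset (Fin n)) ×ˢ P.parts,
      μ.real (B x.1 x.2) ≤ Real.exp (-(ε ^ 2 / 2 * √(n : ℝ))) := by
    rintro ⟨u, C⟩ hx
    have hC := (Finset.mem_product.1 hx).2
    have hpos : (0 : ℝ) < C.card := by exact_mod_cast (P.nonempty_of_mem_parts hC).card_pos
    have hs : sgn u C ^ 2 = 1 := by simp only [sgn]; split_ifs <;> norm_num
    refine (measure_degree_deviation_le h0 h1 u C hs (by positivity)).trans ?_
    refine Real.exp_le_exp.2 (neg_le_neg ?_)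
    have : 2 * (ε / 2 * (C.card : ℝ)) ^ 2 / C.card = ε ^ 2 / 2 * C.card := by
      field_simp
    rw [this]
    have := hsize C hC
    gcongr
  calc _ ≤ μ.real (⋃ 𝒟 ∈ P.parts.powerset.filter Finset.Nonempty, A 𝒟) +
        μ.real (⋃ x ∈ (Finset.univ : Finset (Fin n)) ×ˢ P.parts, B x.1 x.2) :=
        (measureReal_mono hsub (measure_ne_top _ _)).trans (measureReal_union_le _ _)
    _ ≤ ∑ 𝒟 ∈ P.parts.powerset.filter Finset.Nonempty, 2 * Real.exp (-(11 * √(n : ℝ))) +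
        ∑ x ∈ (Finset.univ : Finset (Fin n)) ×ˢ P.parts, Real.exp (-(ε ^ 2 / 2 * √(n : ℝ))) :=
        add_le_add
          ((measureReal_biUnion_finset_le _ _).trans (Finset.sum_le_sum hA))
          ((measureReal_biUnion_finset_le _ _).trans (Finset.sum_le_sum hB))
    _ ≤ _ := by
        rw [Finset.sum_const, Finset.sum_const, nsmul_eq_mul, nsmul_eq_mul]
        refine add_le_add ?_ ?_
        · have h2 : ((P.parts.powerset.filter Finset.Nonempty).card : ℝ) ≤ Real.exp (√(n : ℝ)) := by
            calc ((P.parts.powerset.filter Finset.Nonempty).card : ℝ) ≤ 2 ^ P.parts.card := by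
                  exact_mod_cast (Finset.card_filter_le _ _).trans_eq (Finset.card_powerset _)
              _ ≤ (Real.exp 1) ^ P.parts.card := by
                  gcongr
                  linarith [Real.add_one_le_exp 1]
              _ = Real.exp (P.parts.card) := by rw [← Real.exp_nat_mul, mul_one]
              _ ≤ _ := Real.exp_le_exp.2 hcard2
          calc _ ≤ Real.exp (√(n : ℝ)) * (2 * Real.exp (-(11 * √(n : ℝ)))) := by gcongr
            _ = _ := by
              rw [mul_left_comm, ← Real.exp_add]
              congr 2
              ring
        · gcongr
          rw [Finset.card_product, Finset.card_univ, Fintype.card_fin]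
          have : n * P.parts.card ≤ n ^ 2 := by rw [sq]; gcongr
          exact_mod_cast this

/-- A lower bound for the probability of a set of graphs, from an upper bound for its complement in
terms of the coins; the set need not be known to be measurable. -/
lemma one_sub_le_model (hq : 0 ≤ q) (hqp : q ≤ p) (hp : p ≤ 1) {δ : ℝ}
    {s : Set (SimpleGraph (Fin n))}
    (h : (Measure.pi fun e : Sym2 (Fin n) => coin (edgeProb P p q e)).real
      {ω | coinGraph ω ∉ s} ≤ δ) : 1 - δ ≤ (model P p q).real s := by
  have hprob : ∀ e, IsProbabilityMeasure (coin (edgeProb P p q e)) := fun e =>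
    isProbabilityMeasure_coin (edgeProb_nonneg hq hqp e) (edgeProb_le_one hqp hp e)
  set μ := Measure.pi fun e => coin (edgeProb P p q e) with hμ
  have hμ1 : IsProbabilityMeasure μ := by rw [hμ]; infer_instance
  have hmeas : Measurable (coinGraph : (Sym2 (Fin n) → Prop) → SimpleGraph (Fin n)) :=
    measurable_of_countable _
  have hmodel : model P p q = μ.map coinGraph := rfl
  have hmp : IsProbabilityMeasure (model P p q) := by
    rw [hmodel]; exact Measure.isProbabilityMeasure_map hmeas.aemeasurable
  have h1 : μ.real (coinGraph ⁻¹' s) ≤ (model P p q).real s :=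
    ENNReal.toReal_mono (measure_ne_top _ _) (Measure.le_map_apply hmeas.aemeasurable s)
  have h2 : (1 : ℝ) ≤ μ.real {ω | coinGraph ω ∉ s} + μ.real (coinGraph ⁻¹' s) := by
    rw [← probReal_univ (μ := μ)]
    refine (measureReal_mono ?_ (measure_ne_top _ _)).trans (measureReal_union_le _ _)
    intro ω _
    by_cases hω : coinGraph ω ∈ s
    · exact Or.inr hω
    · exact Or.inl hω
  linarith

/-- For large `n` the failure probability is below the required bound. The factor `n ^ 2` costs
half of the exponent. -/
lemma exists_forall_error_le {γ : ℝ} (hγ : 0 < γ) (hγ1 : γ ≤ 1) :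
    ∃ N : ℕ, ∀ n : ℕ, N ≤ n →
      2 * Real.exp (-(10 * √(n : ℝ))) + n ^ 2 * Real.exp (-(2 * γ * √(n : ℝ))) ≤
        (2 : ℝ) ^ (-(γ * √(n : ℝ))) := by
  have hsqrt : Filter.Tendsto (fun n : ℕ => √(n : ℝ)) Filter.atTop Filter.atTop :=
    Real.tendsto_sqrt_atTop.comp tendsto_natCast_atTop_atTop
  have h4 := (tendsto_rpow_mul_exp_neg_mul_atTop_nhds_zero 4 γ hγ).comp hsqrt
  have h0 := (tendsto_rpow_mul_exp_neg_mul_atTop_nhds_zero 0 γ hγ).comp hsqrt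
  obtain ⟨N, hN⟩ := Filter.eventually_atTop.1
    ((h4.eventually_le_const (u := 1 / 2) (by norm_num)).and
      (h0.eventually_le_const (u := 1 / 4) (by norm_num)))
  refine ⟨N, fun n hn => ?_⟩
  obtain ⟨h4, h0⟩ := hN n hn
  simp only [Function.comp_apply, Real.rpow_zero, one_mul] at h4 h0
  set t := √(n : ℝ) with ht
  have ht0 : 0 ≤ t := Real.sqrt_nonneg _
  have hn2 : (n : ℝ) ^ 2 = t ^ (4 : ℝ) := by
    rw [show (4 : ℝ) = (4 : ℕ) by norm_num, Real.rpow_natCast,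
      show t ^ 4 = (t ^ 2) ^ 2 by ring, ht, Real.sq_sqrt (Nat.cast_nonneg n)]
  have e1 : Real.exp (-(2 * γ * t)) = Real.exp (-γ * t) * Real.exp (-γ * t) := by
    rw [← Real.exp_add]; congr 1; ring
  have e2 : Real.exp (-(10 * t)) ≤ Real.exp (-γ * t) * Real.exp (-γ * t) := by
    rw [← Real.exp_add]
    refine Real.exp_le_exp.2 ?_
    nlinarith
  have e3 : Real.exp (-γ * t) ≤ (2 : ℝ) ^ (-(γ * t)) := by
    rw [Real.rpow_def_of_pos two_pos]
    refine Real.exp_le_exp.2 ?_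
    have : Real.log 2 ≤ 1 := by linarith [Real.log_two_lt_d9]
    nlinarith [mul_nonneg hγ.le ht0]
  have hpos := Real.exp_pos (-γ * t)
  calc _ ≤ 2 * (Real.exp (-γ * t) * Real.exp (-γ * t)) +
        t ^ (4 : ℝ) * (Real.exp (-γ * t) * Real.exp (-γ * t)) := by
        rw [hn2, e1]; gcongr
    _ = (2 * Real.exp (-γ * t) + t ^ (4 : ℝ) * Real.exp (-γ * t)) * Real.exp (-γ * t) := by ring
    _ ≤ 1 * Real.exp (-γ * t) := by gcongr; linarith
    _ ≤ _ := by rw [one_mul]; exact e3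

end RandomGraph

end

end PlantedPartition

theorem mainTheorem1 :
    ∃ a : ℝ, 0 < a ∧ ∃ b : ℝ, 0 < b ∧
      ∀ p q ε : ℝ, 0 ≤ q → q < p → p ≤ 1 → 0 < ε → ε ≤ a * (p - q) →
        ∃ γ : ℝ, 0 < γ ∧ ∃ N : ℕ,
          ∀ c : ℝ, b / ((p - q) * ε) ≤ c →
          ∀ n : ℕ, N ≤ n →
          ∀ (P : Finpartition (Finset.univ : Finset (Fin n))) (K : ℕ)
            (S : Fin K → Finset (Finset (Fin n))),
            PlantedPartition.IsSuperclustering P S ε c →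
            1 - (2 : ℝ) ^ (-(γ * √(n : ℝ))) ≤
              (PlantedPartition.model P p q).real
                {G | PlantedPartition.Recovers G p q ε (List.ofFn fun i => (S i).card) P} := by
  open PlantedPartition in
  -- `a = 1 / 100` separates the degrees `p` and `q` by much more than the errors of order `ε` in an
  -- iteration; `b = 10000` makes the relative spectral error smaller than `ε / 1000`.
  refine ⟨1 / 100, by norm_num, 10000, by norm_num, fun p q ε hq hqp hp hε hεa => ?_⟩
  have hε1 : ε ≤ 1 / 100 := by linarith
  obtain ⟨N, hN⟩ := exists_forall_error_le (γ := ε ^ 2 / 4) (by positivity) (by nlinarith)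
  refine ⟨ε ^ 2 / 4, by positivity, max N 1, fun c hc n hn P K S hS => ?_⟩
  have hΔε : 0 < (p - q) * ε := mul_pos (by linarith) hε
  have hc0 : 0 < c := lt_of_lt_of_le (by positivity) hc
  have hc2 : 10000 ≤ (p - q) * ε * c := by rwa [div_le_iff₀' hΔε] at hc
  have hn1 : 0 < n := lt_of_lt_of_le one_pos ((le_max_right N 1).trans hn)
  have hsn : 1 ≤ √(n : ℝ) := Real.one_le_sqrt.2 (by exact_mod_cast hn1)
  have hεc : 10000 ≤ ε * c := by
    have : 0 < ε * c := mul_pos hε hc0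
    nlinarith
  have hc1 : 1 ≤ c := by nlinarith
  refine one_sub_le_model hq hqp.le hp ((MeasureTheory.measureReal_mono ?_ ?_).trans
    ((measure_not_isGoodGraph_le (P := P) (ε := ε) hq hqp.le hp hε ?_ ?_).trans ?_))
  · intro ω hω hgood
    exact hω (recovers_of_isGoodGraph hq hp hε (by linarith) hn1 hc0 hc2 hS hgood)
  · have hprob : ∀ e, MeasureTheory.IsProbabilityMeasure (coin (edgeProb P p q e)) := fun e =>
      isProbabilityMeasure_coin (edgeProb_nonneg hq hqp.le e) (edgeProb_le_one hqp.le hp e)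
    exact MeasureTheory.measure_ne_top _ _
  · intro C hC
    refine le_trans ?_ (hS.large C hC)
    nlinarith
  · intro C hC
    have := hS.large C hC
    have h2 : ε * (c * 1) ≤ ε * (c * √(n : ℝ)) := by gcongr
    have h3 : ε * (c * √(n : ℝ)) ≤ ε * C.card := by gcongr
    linarith
  · have := hN n ((le_max_left N 1).trans hn)
    rwa [show 2 * (ε ^ 2 / 4) = ε ^ 2 / 2 by ring] at this
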